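/- Let $d\ge 1$ be an integer and $\beta>0$ be such that $2\beta+d-2>0$ and, if $d\ge 3$, also $\beta\ge 1$. Let $\mathcal H^\beta_K([0,1]^d)$ be the set of continuous $f:[0,1]^d\to\mathbb R$ whose partial derivatives up to order $s$ exist and are continuous in $(0,1)^d$ and whose $\beta$-Hölder norm $$\max_{|k|\le s}\sup_{x}|D^kf(x)|+\max_{|k|=s}\sup_{x\ne y}\frac{|D^kf(x)-D^kf(y)|}{|x-y|^{\beta-s}}$$ is at most $K$; here $s$ is the largest integer strictly smaller than $\beta$ and the suprema are over $(0,1)^d$. For $D\ge d$ let $\mathcal G_0$ be the set of maps $g=(g_1,\dots,g_D):[0,1]^d\to\mathbb R^D$ with all $g_i\in\mathcal H^\beta_K([0,1]^d)$. For $g\in\mathcal G_0$ let $Q_g$ be the law of $g(Z)$ with $Z$ uniform on $[0,1]^d$, and for $\sigma_0\ge 0$ let $P_{g,\sigma_0}=Q_g*\mathcal N(0,\sigma_0^2 I_D)$. Define the minimax risk $$\mathfrak M_n(\mathcal G_0,\sigma_0)=\inf_{\hat Q}\ \sup_{g\in\mathcal G_0}\ \mathbb E\,W_1(\hat Q,Q_g),$$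 where $W_1$ is the $L^1$-Wasserstein distance for the Euclidean distance on $\mathbb R^D$, the infimum is over all (measurable) estimators $\hat Q=\hat Q(X_1,\dots,X_n)$ with values in the probability measures on $\mathbb R^D$, and $X_1,\dots,X_n$ are i.i.d. with law $P_{g,\sigma_0}$. Then there are constants $K_0$ and $C>0$, depending only on $\beta$ and $d$, such that for all $K\ge K_0$, all $D\ge d$, all $\sigma_0\ge 0$ and all $n\ge 1$, $$\mathfrak M_n(\mathcal G_0,\sigma_0)\ \ge\ C\,n^{-\frac{\beta}{2\beta+d-2}}.$$ -/

import Mathlib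

open MeasureTheory ProbabilityTheory
open scoped ENNReal

noncomputable section

/-- The closed unit cube `[0,1]^d` in `ℝ^d`. -/
def unitCube (d : ℕ) : Set (EuclideanSpace ℝ (Fin d)) :=
  {z | ∀ i, 0 ≤ z i ∧ z i ≤ 1}

/-- The uniform distribution on `[0,1]^d`: Lebesgue measure restricted to the cube. -/
def uniformCube (d : ℕ) : Measure (EuclideanSpace ℝ (Fin d)) :=
  volume.restrict (unitCube d)

/-- The largest integer strictly smaller than `β` (for `β > 0`). -/
def holderOrder (β : ℝ) : ℕ := ⌈β⌉₊ - 1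

/-- The mixed partial derivative `∂_{i_1} ⋯ ∂_{i_j} f (x)` of order `j`. When `i` runs over all
`j`-tuples, this runs over all partial derivatives `D^k f` with `|k| = j` of a `C^j` function. -/
def partialDeriv {d j : ℕ} (i : Fin j → Fin d) (f : EuclideanSpace ℝ (Fin d) → ℝ)
    (x : EuclideanSpace ℝ (Fin d)) : ℝ :=
  iteratedFDeriv ℝ j f x (fun l => EuclideanSpace.single (i l) (1 : ℝ))

/-- The `β`-Hölder norm on `A`, with values in `[0, ∞]`: the maximum over all multi-indices
`|k| ≤ s` of `sup |D^k f|`, plus the maximum over all `|k| = s` of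
`sup_{x ≠ y} |D^k f(x) - D^k f(y)| / |x - y|^(β - s)`, where `s` is the largest integer strictly
smaller than `β` and the suprema are over the interior of `A`. -/
def holderNorm {d : ℕ} (β : ℝ) (A : Set (EuclideanSpace ℝ (Fin d)))
    (f : EuclideanSpace ℝ (Fin d) → ℝ) : ℝ≥0∞ :=
  (⨆ (j : ℕ) (_ : j ≤ holderOrder β) (i : Fin j → Fin d) (x ∈ interior A),
      ENNReal.ofReal |partialDeriv i f x|) +
  (⨆ (i : Fin (holderOrder β) → Fin d) (x ∈ interior A) (y ∈ interior A) (_ : x ≠ y),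
      ENNReal.ofReal
        (|partialDeriv i f x - partialDeriv i f y| / ‖x - y‖ ^ (β - (holderOrder β : ℝ))))

/-- The `β`-Hölder ball `H^β_K(A)`: functions which are continuous on `A`, have continuous partial
derivatives in the interior of `A` up to the order that enters the norm, and have `β`-Hölder norm
at most `K`. Only the values on `A` matter. -/
def holderBall {d : ℕ} (β K : ℝ) (A : Set (EuclideanSpace ℝ (Fin d))) :
    Set (EuclideanSpace ℝ (Fin d) → ℝ) :=
  {f | ContinuousOn f A ∧ ContDiffOn ℝ (holderOrder β : ℕ) f (interior A) ∧
    holderNorm β A f ≤ ENNReal.ofReal K}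

/-- The class of generators `H^β_K([0,1]^d) × ⋯ × H^β_K([0,1]^d)` (`D` factors). -/
def generatorClass (d D : ℕ) (β K : ℝ) :
    Set (EuclideanSpace ℝ (Fin d) → EuclideanSpace ℝ (Fin D)) :=
  {g | ∀ i : Fin D, (fun z => g z i) ∈ holderBall β K (unitCube d)}

/-- `Q_g`: the law of `g(Z)`, where `Z` is uniform on `[0,1]^d`. -/
def generatedLaw {d D : ℕ} (g : EuclideanSpace ℝ (Fin d) → EuclideanSpace ℝ (Fin D)) :
    Measure (EuclideanSpace ℝ (Fin D)) :=
  (uniformCube d).map g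

/-- `P_{g,σ} = Q_g * N(0, σ² I)`: the law of one observation. -/
def dataLaw {d D : ℕ} (g : EuclideanSpace ℝ (Fin d) → EuclideanSpace ℝ (Fin D)) (σ : ℝ) :
    Measure (EuclideanSpace ℝ (Fin D)) :=
  (generatedLaw g).conv
    (multivariateGaussian 0 (σ ^ 2 • (1 : Matrix (Fin D) (Fin D) ℝ)))

/-- The `L¹`-Wasserstein distance: the infimum of `∫ |x - y| dπ(x, y)` over all couplings `π` of
`μ` and `ν`. -/
def wasserstein1 {D : ℕ} (μ ν : Measure (EuclideanSpace ℝ (Fin D))) : ℝ≥0∞ :=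
  ⨅ (π : Measure (EuclideanSpace ℝ (Fin D) × EuclideanSpace ℝ (Fin D)))
    (_ : π.map Prod.fst = μ ∧ π.map Prod.snd = ν), ∫⁻ p, edist p.1 p.2 ∂π

/-- Estimators of a distribution on `ℝ^D` from `n` observations: measurable maps from the sample
space to the probability measures on `ℝ^D`. -/
def estimators (n D : ℕ) :
    Set ((Fin n → EuclideanSpace ℝ (Fin D)) → Measure (EuclideanSpace ℝ (Fin D))) :=
  {Qhat | Measurable Qhat ∧ ∀ x, IsProbabilityMeasure (Qhat x)}

/-- The minimax risk over the class `G` at noise level `σ` for the sample size `n`: the infimum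
over all estimators of the supremum over `g ∈ G` of the expected `W₁`-distance between the
estimator and `Q_g`, when the `n` observations are i.i.d. with law `P_{g,σ}`. -/
def wassersteinMinimaxRisk {d D : ℕ} (G : Set (EuclideanSpace ℝ (Fin d) → EuclideanSpace ℝ (Fin D)))
    (σ : ℝ) (n : ℕ) : ℝ≥0∞ :=
  ⨅ Qhat ∈ estimators n D, ⨆ g ∈ G,
    ∫⁻ x, wasserstein1 (Qhat x) (generatedLaw g) ∂(Measure.pi fun _ : Fin n => dataLaw g σ)

end

/-!
The bound is Assouad's lemma over the hypercube of generators obtained from an isometric embedding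
of the unit cube by adding, on each cell of a grid of mesh `h`, a bump of height `a h` or nothing,
always in the same direction `v`. Adding one more bump amounts to composing with a shear, which
preserves the cell and whose Jacobian is `1` plus the derivative of the bump along `v`, of order
`a`. So one extra bump changes the law of an observation by a `χ²`-divergence of order `a² h ^ d`;
convolving with noise only brings the laws closer, and as long as `n a² h ^ d` stays small the two
samples cannot be told apart, whatever the noise level. Disjointly supported 1-Lipschitz functions,
one for each cell, bound `W₁` from below by a sum over the cells, and each bump shifts the mean of
its test function by a multiple of `a h ^ (d + 1)`. This gives a risk of order `a h`. For `β ≥ 1`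
smoothness forces `a ≤ h ^ (β - 1)`, and `n h ^ (2β + d - 2) ≈ 1` is the best choice; for `d ≤ 2` a
single cell with `a ≈ n ^ (-1 / 2)` already gives a rate that is at least as large.
-/

noncomputable section

/-! ### Le Cam's two-point method and Assouad's lemma -/

section TestingAffinity

variable {X Y : Type*} [MeasurableSpace X] [MeasurableSpace Y]

/-- The testing affinity of two measures, the mass of their infimum. For probability measures this
is one minus the total variation distance. -/
def testingAffinity (P Q : Measure X) : ℝ≥0∞ :=
  (P ⊓ Q) Set.univ

theorem testingAffinity_comm (P Q : Measure X) : testingAffinity P Q = testingAffinity Q P := by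
  rw [testingAffinity, inf_comm, testingAffinity]

theorem testingAffinity_le_map (P Q : Measure X) {f : X → Y} (hf : Measurable f) :
    testingAffinity P Q ≤ testingAffinity (P.map f) (Q.map f) := by
  calc testingAffinity P Q = ((P ⊓ Q).map f) Set.univ := by
        rw [Measure.map_apply hf MeasurableSet.univ, Set.preimage_univ, testingAffinity]
    _ ≤ testingAffinity (P.map f) (Q.map f) :=
        le_inf (Measure.map_mono inf_le_left hf) (Measure.map_mono inf_le_right hf) _

theorem testingAffinity_pi_le_pi_map {ι : Type*} [Fintype ι] (μ ν : Measure X) {f : X → Y}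
    (hf : Measurable f) [SigmaFinite (μ.map f)] [SigmaFinite (ν.map f)] :
    testingAffinity (Measure.pi fun _ : ι => μ) (Measure.pi fun _ : ι => ν) ≤
      testingAffinity (Measure.pi fun _ : ι => μ.map f) (Measure.pi fun _ : ι => ν.map f) := by
  rw [← Measure.pi_map_pi fun _ => hf.aemeasurable, ← Measure.pi_map_pi fun _ => hf.aemeasurable]
  exact testingAffinity_le_map _ _ (by fun_prop)

theorem half_le_testingAffinity_withDensity (μ : Measure X) {J : X → ℝ≥0∞} (hJ : Measurable J)
    (h1 : ∫⁻ x, J x ∂μ = 1) (h2 : ∫⁻ x, J x ^ 2 ∂μ ≤ 2) :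
    1 / 2 ≤ testingAffinity μ (μ.withDensity J) := by
  have hmin : μ.withDensity (fun x => min 1 (J x)) ≤ μ ⊓ μ.withDensity J := by
    refine le_inf ?_ (withDensity_mono (.of_forall fun x => min_le_right _ _))
    conv_rhs => rw [← withDensity_one (μ := μ)]
    exact withDensity_mono (.of_forall fun x => min_le_left _ _)
  have hpt : ∀ t : ℝ≥0∞, t ≤ min 1 t + t ^ 2 / 4 := by
    intro t
    rcases le_total t 1 with ht | ht
    · rw [min_eq_right ht]
      exact le_self_add
    rcases eq_or_ne t ⊤ with rfl | htop
    · simp [ENNReal.top_div]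
    lift t to NNReal using htop
    rw [min_eq_left ht]
    have : (t : ℝ) ≤ 1 + t ^ 2 / 4 := by nlinarith [sq_nonneg ((t : ℝ) - 2)]
    have : t ≤ 1 + t ^ 2 / 4 := by exact_mod_cast this
    simpa using ENNReal.coe_le_coe.2 this
  have hle : (1 : ℝ≥0∞) ≤ ∫⁻ x, min 1 (J x) ∂μ + 1 / 2 := by
    calc (1 : ℝ≥0∞) ≤ ∫⁻ x, (min 1 (J x) + J x ^ 2 / 4) ∂μ :=
          h1.ge.trans (lintegral_mono fun x => hpt (J x))
      _ = ∫⁻ x, min 1 (J x) ∂μ + (∫⁻ x, J x ^ 2 ∂μ) / 4 := by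
          simp only [div_eq_mul_inv]
          rw [lintegral_add_left (by fun_prop), lintegral_mul_const _ (by fun_prop)]
      _ ≤ ∫⁻ x, min 1 (J x) ∂μ + 2 / 4 := by gcongr
      _ = ∫⁻ x, min 1 (J x) ∂μ + 1 / 2 := by
          congr 1
          rw [ENNReal.div_eq_div_iff] <;> norm_num
  calc (1 : ℝ≥0∞) / 2 = 1 - 1 / 2 := by simp
    _ ≤ ∫⁻ x, min 1 (J x) ∂μ := tsub_le_iff_right.2 hle
    _ = μ.withDensity (fun x => min 1 (J x)) Set.univ := by
        rw [withDensity_apply _ MeasurableSet.univ, Measure.restrict_univ]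
    _ ≤ testingAffinity μ (μ.withDensity J) := hmin _

end TestingAffinity

section ProductMeasure

variable {ι X : Type*} [Fintype ι] [MeasurableSpace X] (μ : Measure X) [IsProbabilityMeasure μ]
  {J : X → ℝ≥0∞}

theorem lintegral_pi_prod_eq_prod {f : ι → X → ℝ≥0∞} (hf : ∀ i, Measurable (f i)) :
    ∫⁻ x, ∏ i, f i (x i) ∂(Measure.pi fun _ : ι => μ) = ∏ i, ∫⁻ x, f i x ∂μ := by
  rw [lintegral_prod_eq_prod_lintegral_of_indepFun Finset.univ (fun i (x : ι → X) => f i (x i))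
    (iIndepFun_pi fun i => (hf i).aemeasurable) fun i => (hf i).comp (measurable_pi_apply i)]
  refine Finset.prod_congr rfl fun i _ => ?_
  exact (measurePreserving_eval (fun _ : ι => μ) i).lintegral_comp (hf i)

theorem pi_withDensity (hJ : Measurable J) [SigmaFinite (μ.withDensity J)] :
    Measure.pi (fun _ : ι => μ.withDensity J) =
      (Measure.pi fun _ : ι => μ).withDensity fun x => ∏ i, J (x i) := by
  classical
  refine Measure.pi_eq fun s hs => ?_
  have hprod : ∀ x : ι → X, (Set.univ.pi s).indicator (fun x => ∏ i, J (x i)) x =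
      ∏ i, (s i).indicator J (x i) := fun x => by
    simp only [Set.indicator_apply, Set.mem_univ_pi, Finset.prod_ite_zero, Finset.mem_univ,
      true_imp_iff]
  rw [withDensity_apply _ (.univ_pi hs), ← lintegral_indicator (.univ_pi hs)]
  simp_rw [hprod]
  rw [lintegral_pi_prod_eq_prod μ fun i => hJ.indicator (hs i)]
  exact Finset.prod_congr rfl fun i _ => by
    rw [withDensity_apply _ (hs i), lintegral_indicator (hs i)]

theorem half_le_testingAffinity_pi_withDensity (hJ : Measurable J) (h1 : ∫⁻ x, J x ∂μ = 1)
    (h2 : (∫⁻ x, J x ^ 2 ∂μ) ^ Fintype.card ι ≤ 2) :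
    1 / 2 ≤ testingAffinity (Measure.pi fun _ : ι => μ)
      (Measure.pi fun _ : ι => μ.withDensity J) := by
  have : IsFiniteMeasure (μ.withDensity J) := isFiniteMeasure_withDensity (by simp [h1])
  rw [pi_withDensity μ hJ]
  refine half_le_testingAffinity_withDensity _ (by fun_prop) ?_ ?_
  · rw [lintegral_pi_prod_eq_prod μ fun _ => hJ, h1, Finset.prod_const_one]
  · simp_rw [← Finset.prod_pow]
    rwa [lintegral_pi_prod_eq_prod μ fun _ => hJ.pow_const 2, Finset.prod_const, Finset.card_univ]

theorem half_le_testingAffinity_pi_map_conv {F : Type*} [MeasurableSpace F] [AddMonoid F]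
    [MeasurableAdd₂ F] (γ : Measure F) [IsProbabilityMeasure γ] {g : X → F} (hg : Measurable g)
    (hJ : Measurable J) (h1 : ∫⁻ x, J x ∂μ = 1) (h2 : (∫⁻ x, J x ^ 2 ∂μ) ^ Fintype.card ι ≤ 2) :
    1 / 2 ≤ testingAffinity (Measure.pi fun _ : ι => (μ.map g).conv γ)
      (Measure.pi fun _ : ι => ((μ.withDensity J).map g).conv γ) := by
  have : IsFiniteMeasure (μ.withDensity J) := isFiniteMeasure_withDensity (by simp [h1])
  have hconv : ∀ ν : Measure X, IsFiniteMeasure ν →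
      (ν.map g).conv γ = (ν.prod γ).map fun p => g p.1 + p.2 := fun ν _ => by
    conv_lhs => rw [← Measure.map_id (μ := γ)]
    rw [Measure.conv, Measure.map_prod_map _ _ hg measurable_id,
      Measure.map_map measurable_add (hg.prodMap measurable_id)]
    rfl
  have hfst : ∀ f : X → ℝ≥0∞, Measurable f → ∫⁻ p, f p.1 ∂(μ.prod γ) = ∫⁻ x, f x ∂μ :=
    fun f hf => (measurePreserving_fst (μ := μ) (ν := γ)).lintegral_comp hf
  rw [hconv μ inferInstance, hconv (μ.withDensity J) inferInstance]
  refine le_trans ?_ (testingAffinity_pi_le_pi_map _ _ (by fun_prop))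
  rw [prod_withDensity_left hJ]
  refine half_le_testingAffinity_pi_withDensity _ (by fun_prop) ?_ ?_
  · rw [hfst J hJ, h1]
  · rwa [hfst _ (hJ.pow_const 2)]

end ProductMeasure

section Assouad

variable {X Θ ι : Type*} [MeasurableSpace X] [PseudoEMetricSpace Θ] [MeasurableSpace Θ]
  [OpensMeasurableSpace Θ]

theorem edist_mul_testingAffinity_le (P₀ P₁ : Measure X) {T : X → Θ} (hT : Measurable T)
    (θ₀ θ₁ : Θ) :
    edist θ₀ θ₁ * testingAffinity P₀ P₁ ≤
      ∫⁻ x, edist (T x) θ₀ ∂P₀ + ∫⁻ x, edist (T x) θ₁ ∂P₁ := by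
  have hmeas : ∀ θ : Θ, Measurable fun x => edist (T x) θ := fun θ =>
    measurable_edist_left.comp hT
  calc edist θ₀ θ₁ * testingAffinity P₀ P₁ = ∫⁻ _, edist θ₀ θ₁ ∂(P₀ ⊓ P₁) := by
        rw [lintegral_const, testingAffinity]
    _ ≤ ∫⁻ x, (edist (T x) θ₀ + edist (T x) θ₁) ∂(P₀ ⊓ P₁) :=
        lintegral_mono fun x => edist_triangle_left _ _ _
    _ = ∫⁻ x, edist (T x) θ₀ ∂(P₀ ⊓ P₁) + ∫⁻ x, edist (T x) θ₁ ∂(P₀ ⊓ P₁) :=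
        lintegral_add_left (hmeas θ₀) _
    _ ≤ ∫⁻ x, edist (T x) θ₀ ∂P₀ + ∫⁻ x, edist (T x) θ₁ ∂P₁ :=
        add_le_add (lintegral_mono' inf_le_left le_rfl) (lintegral_mono' inf_le_right le_rfl)

variable [Fintype ι] [DecidableEq ι]

theorem card_mul_le_two_mul_sum_finset (f : Finset ι → ℝ≥0∞) (j : ι) {c : ℝ≥0∞}
    (h : ∀ s, j ∉ s → c ≤ f s + f (insert j s)) :
    Fintype.card (Finset ι) * c ≤ 2 * ∑ s, f s := by
  have hsplit : ∀ u : Finset ι → ℝ≥0∞,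
      ∑ s, u s = ∑ s ∈ (Finset.univ.erase j).powerset, (u s + u (insert j s)) := fun u => by
    rw [Finset.sum_add_distrib, ← Finset.sum_powerset_insert (Finset.notMem_erase j _),
      Finset.insert_erase (Finset.mem_univ j), Finset.powerset_univ]
  calc Fintype.card (Finset ι) * c = ∑ _s : Finset ι, c := by simp
    _ = ∑ s ∈ (Finset.univ.erase j).powerset, 2 * c := by simp_rw [hsplit fun _ => c, two_mul]
    _ ≤ ∑ s ∈ (Finset.univ.erase j).powerset, 2 * (f s + f (insert j s)) := by
        refine Finset.sum_le_sum fun s hs => ?_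
        gcongr
        exact h s fun hj => Finset.notMem_erase j _ (Finset.mem_powerset.1 hs hj)
    _ = 2 * ∑ s, f s := by rw [hsplit f, Finset.mul_sum]

/-- The vertices of the hypercube are encoded as the subsets of `ι`. -/
theorem assouad (P : Finset ι → Measure X) (θ : Finset ι → ι → Θ) {T : X → ι → Θ}
    (hT : ∀ j, Measurable fun x => T x j) {p δ : ℝ≥0∞}
    (hp : ∀ s, ∀ j ∉ s, p ≤ testingAffinity (P s) (P (insert j s)))
    (hδ : ∀ s, ∀ j ∉ s, δ ≤ edist (θ s j) (θ (insert j s) j)) :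
    Fintype.card ι * (δ * p / 2) ≤ ⨆ s, ∫⁻ x, ∑ j, edist (T x j) (θ s j) ∂(P s) := by
  set R := ⨆ s, ∫⁻ x, ∑ j, edist (T x j) (θ s j) ∂(P s)
  have hcoord : ∀ j, Fintype.card (Finset ι) * (δ * p) ≤
      2 * ∑ s, ∫⁻ x, edist (T x j) (θ s j) ∂(P s) := fun j =>
    card_mul_le_two_mul_sum_finset _ j fun s hj => (mul_le_mul' (hδ s j hj) (hp s j hj)).trans
      (edist_mul_testingAffinity_le _ _ (hT j) _ _)
  have hsum : Fintype.card (Finset ι) * (Fintype.card ι * (δ * p)) ≤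
      Fintype.card (Finset ι) * (2 * R) := by
    calc Fintype.card (Finset ι) * (Fintype.card ι * (δ * p))
        = ∑ _j : ι, Fintype.card (Finset ι) * (δ * p) := by
          rw [Finset.sum_const, Finset.card_univ, nsmul_eq_mul, mul_left_comm]
      _ ≤ ∑ j, 2 * ∑ s, ∫⁻ x, edist (T x j) (θ s j) ∂(P s) :=
          Finset.sum_le_sum fun j _ => hcoord j
      _ = 2 * ∑ s, ∫⁻ x, ∑ j, edist (T x j) (θ s j) ∂(P s) := by
          rw [← Finset.mul_sum, Finset.sum_comm]
          congr 1
          refine Finset.sum_congr rfl fun s _ => (lintegral_finsetSum _ fun j _ => ?_).symm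
          exact measurable_edist_left.comp (hT j)
      _ ≤ 2 * ∑ _s : Finset ι, R := by
          gcongr with s
          exact le_iSup (fun s => ∫⁻ x, ∑ j, edist (T x j) (θ s j) ∂(P s)) s
      _ = Fintype.card (Finset ι) * (2 * R) := by
          rw [Finset.sum_const, Finset.card_univ, nsmul_eq_mul, mul_left_comm]
  rw [ENNReal.mul_le_mul_iff_right (by simp) (by simp)] at hsum
  rw [← mul_div_assoc]
  exact ENNReal.div_le_of_le_mul' hsum

end Assouad

/-! ### Lower bounds for the Wasserstein risk -/

section Wasserstein

variable {ι : Type*} [Fintype ι]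

theorem sum_edist_le_two_mul_edist {X : Type*} [PseudoEMetricSpace X] {φ : ι → X → ℝ}
    (hL : ∀ j, LipschitzWith 1 (φ j))
    (hdisj : Pairwise fun i j => Disjoint (Function.support (φ i)) (Function.support (φ j)))
    (x y : X) :
    ∑ j, edist (φ j x) (φ j y) ≤ 2 * edist x y := by
  classical
  have hcard : ∀ z, (Finset.univ.filter fun j => φ j z ≠ 0).card ≤ 1 := fun z =>
    Finset.card_le_one.2 fun i hi j hj => by_contra fun hij =>
      Set.disjoint_left.1 (hdisj hij) (Finset.mem_filter.1 hi).2 (Finset.mem_filter.1 hj).2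
  set s := (Finset.univ.filter fun j => φ j x ≠ 0) ∪ Finset.univ.filter fun j => φ j y ≠ 0 with hs
  have hs2 : s.card ≤ 2 := (Finset.card_union_le _ _).trans (add_le_add (hcard x) (hcard y))
  calc ∑ j, edist (φ j x) (φ j y) = ∑ j ∈ s, edist (φ j x) (φ j y) := by
        refine (Finset.sum_subset (Finset.subset_univ s) fun j _ hj => ?_).symm
        have : φ j x = 0 ∧ φ j y = 0 := by simpa [hs] using hj
        rw [this.1, this.2, edist_self]
    _ ≤ ∑ _j ∈ s, edist x y := by
        refine Finset.sum_le_sum fun j _ => ?_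
        simpa only [ENNReal.coe_one, one_mul] using hL j x y
    _ = s.card * edist x y := by rw [Finset.sum_const, nsmul_eq_mul]
    _ ≤ 2 * edist x y := by gcongr; exact_mod_cast hs2

variable {D : ℕ} {φ : ι → EuclideanSpace ℝ (Fin D) → ℝ}

theorem sum_edist_integral_le_two_mul_wasserstein1 (hL : ∀ j, LipschitzWith 1 (φ j))
    (hdisj : Pairwise fun i j => Disjoint (Function.support (φ i)) (Function.support (φ j)))
    {μ ν : Measure (EuclideanSpace ℝ (Fin D))} (hμ : ∀ j, Integrable (φ j) μ)
    (hν : ∀ j, Integrable (φ j) ν) :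
    ∑ j, edist (∫ x, φ j x ∂μ) (∫ x, φ j x ∂ν) ≤ 2 * wasserstein1 μ ν := by
  rw [mul_comm, ← ENNReal.div_le_iff (by simp) (by simp)]
  refine le_iInf₂ fun π hπ => ?_
  rw [ENNReal.div_le_iff (by simp) (by simp), mul_comm]
  obtain ⟨rfl, rfl⟩ := hπ
  have hcont : ∀ j, Continuous (φ j) := fun j => (hL j).continuous
  have hsub : ∀ j, ∫ x, φ j x ∂(π.map Prod.fst) - ∫ x, φ j x ∂(π.map Prod.snd) =
      ∫ z, (φ j z.1 - φ j z.2) ∂π := fun j => by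
    rw [integral_map measurable_fst.aemeasurable (hcont j).aestronglyMeasurable,
      integral_map measurable_snd.aemeasurable (hcont j).aestronglyMeasurable]
    exact (integral_sub ((hμ j).comp_measurable measurable_fst)
      ((hν j).comp_measurable measurable_snd)).symm
  calc ∑ j, edist (∫ x, φ j x ∂(π.map Prod.fst)) (∫ x, φ j x ∂(π.map Prod.snd))
      ≤ ∑ j, ∫⁻ z, edist (φ j z.1) (φ j z.2) ∂π := by
        refine Finset.sum_le_sum fun j _ => ?_
        simp_rw [edist_eq_enorm_sub, hsub j]
        exact enorm_integral_le_lintegral_enorm _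
    _ = ∫⁻ z, ∑ j, edist (φ j z.1) (φ j z.2) ∂π :=
        (lintegral_finsetSum _ fun j _ => by
          have := (hcont j).measurable
          fun_prop).symm
    _ ≤ ∫⁻ z, 2 * edist z.1 z.2 ∂π :=
        lintegral_mono fun z => sum_edist_le_two_mul_edist hL hdisj z.1 z.2
    _ = 2 * ∫⁻ z, edist z.1 z.2 ∂π := lintegral_const_mul _ (by fun_prop)

theorem le_wassersteinMinimaxRisk [DecidableEq ι] {d n : ℕ}
    {G : Set (EuclideanSpace ℝ (Fin d) → EuclideanSpace ℝ (Fin D))} {σ : ℝ}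
    {g : Finset ι → EuclideanSpace ℝ (Fin d) → EuclideanSpace ℝ (Fin D)} (hgG : ∀ s, g s ∈ G)
    (hL : ∀ j, LipschitzWith 1 (φ j)) {B : ℝ} (hB : ∀ j x, |φ j x| ≤ B)
    (hdisj : Pairwise fun i j => Disjoint (Function.support (φ i)) (Function.support (φ j)))
    [∀ s, IsFiniteMeasure (generatedLaw (g s))] {p δ : ℝ≥0∞}
    (hp : ∀ s, ∀ j ∉ s, p ≤ testingAffinity (Measure.pi fun _ : Fin n => dataLaw (g s) σ)
      (Measure.pi fun _ : Fin n => dataLaw (g (insert j s)) σ))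
    (hδ : ∀ s, ∀ j ∉ s, δ ≤ edist (∫ y, φ j y ∂(generatedLaw (g s)))
      (∫ y, φ j y ∂(generatedLaw (g (insert j s))))) :
    Fintype.card ι * (δ * p / 2) / 2 ≤ wassersteinMinimaxRisk G σ n := by
  refine le_iInf₂ fun Qhat hQ => ?_
  have hint : ∀ j (μ : Measure (EuclideanSpace ℝ (Fin D))), IsFiniteMeasure μ →
      Integrable (φ j) μ := fun j μ _ =>
    Integrable.of_bound (hL j).continuous.aestronglyMeasurable B (.of_forall (hB j))
  have hmeas : ∀ j, Measurable fun x => ∫ y, φ j y ∂(Qhat x) := fun j =>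
    (StronglyMeasurable.integral_kernel (κ := ⟨Qhat, hQ.1⟩)
      (hL j).continuous.stronglyMeasurable).measurable
  refine ENNReal.div_le_of_le_mul' ((assouad _ (fun s j => ∫ y, φ j y ∂(generatedLaw (g s)))
    hmeas hp hδ).trans (iSup_le fun s => ?_))
  calc ∫⁻ x, ∑ j, edist (∫ y, φ j y ∂(Qhat x)) (∫ y, φ j y ∂(generatedLaw (g s)))
        ∂(Measure.pi fun _ : Fin n => dataLaw (g s) σ)
      ≤ ∫⁻ x, 2 * wasserstein1 (Qhat x) (generatedLaw (g s))
          ∂(Measure.pi fun _ : Fin n => dataLaw (g s) σ) :=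
        lintegral_mono fun x => by
          have := hQ.2 x
          exact sum_edist_integral_le_two_mul_wasserstein1 hL hdisj
            (fun j => hint j _ inferInstance) fun j => hint j _ inferInstance
    _ = 2 * ∫⁻ x, wasserstein1 (Qhat x) (generatedLaw (g s))
          ∂(Measure.pi fun _ : Fin n => dataLaw (g s) σ) :=
        lintegral_const_mul' _ _ (by simp)
    _ ≤ 2 * ⨆ g ∈ G, ∫⁻ x, wasserstein1 (Qhat x) (generatedLaw g)
          ∂(Measure.pi fun _ : Fin n => dataLaw g σ) := by
        gcongr
        exact le_iSup₂ (f := fun g (_ : g ∈ G) => ∫⁻ x, wasserstein1 (Qhat x) (generatedLaw g)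
          ∂(Measure.pi fun _ : Fin n => dataLaw g σ)) (g s) (hgG s)

end Wasserstein

/-! ### Hölder bounds -/

/-- The bound interpolates between the two hypotheses through `min 1 t ≤ t ^ α`. -/
theorem norm_sub_le_of_fderiv_le {E F : Type*} [NormedAddCommGroup E] [NormedSpace ℝ E]
    [NormedAddCommGroup F] [NormedSpace ℝ F] {A : Set E} (hA : Convex ℝ A) {α : ℝ} (hα0 : 0 ≤ α)
    (hα1 : α ≤ 1) {h N : ℝ} (hh : 0 < h) {f : E → F} (hf : Differentiable ℝ f)
    (hN : ∀ x ∈ A, ‖f x‖ ≤ N) (hN' : ∀ x ∈ A, ‖fderiv ℝ f x‖ ≤ N / h) {x y : E} (hx : x ∈ A)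
    (hy : y ∈ A) :
    ‖f x - f y‖ ≤ 2 * N * (‖x - y‖ / h) ^ α := by
  have hN0 : 0 ≤ N := (norm_nonneg _).trans (hN x hx)
  set t := ‖x - y‖ / h with ht
  have ht0 : 0 ≤ t := by positivity
  have htriv : ‖f x - f y‖ ≤ 2 * N := by linarith [norm_sub_le (f x) (f y), hN x hx, hN y hy]
  have hlip : ‖f x - f y‖ ≤ N * t := by
    refine (hA.norm_image_sub_le_of_norm_fderiv_le (fun z _ => hf z) hN' hy hx).trans_eq ?_
    rw [ht]
    ring
  calc ‖f x - f y‖ ≤ 2 * N * min 1 t := by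
        rw [mul_min_of_nonneg _ _ (by positivity), mul_one]
        exact le_min htriv (hlip.trans (by nlinarith [mul_nonneg hN0 ht0]))
    _ ≤ 2 * N * t ^ α := by
        gcongr
        rcases le_total 1 t with h1 | h1
        · exact (min_le_left _ _).trans (Real.one_le_rpow h1 hα0)
        · exact (min_le_right _ _).trans (Real.self_le_rpow_of_le_one ht0 h1 hα1)

/-- `f` is `s` times continuously differentiable, and on `A` its derivatives up to order `s` and
the `α`-Hölder seminorm of its `s`-th derivative are at most `B` in operator norm. This controls
`holderNorm`, which is phrased with partial derivatives, and applies to vector-valued maps. -/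
structure HolderBoundOn {E F : Type*} [NormedAddCommGroup E] [NormedSpace ℝ E]
    [NormedAddCommGroup F] [NormedSpace ℝ F] (s : ℕ) (α : ℝ) (A : Set E) (B : ℝ) (f : E → F) :
    Prop where
  contDiff : ContDiff ℝ s f
  norm_le : ∀ j ≤ s, ∀ x ∈ A, ‖iteratedFDeriv ℝ j f x‖ ≤ B
  norm_sub_le : ∀ x ∈ A, ∀ y ∈ A,
    ‖iteratedFDeriv ℝ s f x - iteratedFDeriv ℝ s f y‖ ≤ B * ‖x - y‖ ^ α

namespace HolderBoundOn

section NormedSpace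

variable {E F G : Type*} [NormedAddCommGroup E] [NormedSpace ℝ E] [NormedAddCommGroup F]
  [NormedSpace ℝ F] [NormedAddCommGroup G] [NormedSpace ℝ G] {s : ℕ} {α : ℝ} {A : Set E}
  {B B' : ℝ} {f f' : E → F}

theorem mono (h : HolderBoundOn s α A B f) (hB : B ≤ B') : HolderBoundOn s α A B' f where
  contDiff := h.contDiff
  norm_le j hj x hx := (h.norm_le j hj x hx).trans hB
  norm_sub_le x hx y hy := (h.norm_sub_le x hx y hy).trans (by gcongr)

theorem add (h : HolderBoundOn s α A B f) (h' : HolderBoundOn s α A B' f') :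
    HolderBoundOn s α A (B + B') (f + f') := by
  have hadd : ∀ j ≤ s, ∀ x, iteratedFDeriv ℝ j (f + f') x =
      iteratedFDeriv ℝ j f x + iteratedFDeriv ℝ j f' x := fun j hj x =>
    iteratedFDeriv_add_apply (h.contDiff.of_le (by exact_mod_cast hj)).contDiffAt
      (h'.contDiff.of_le (by exact_mod_cast hj)).contDiffAt
  refine ⟨h.contDiff.add h'.contDiff, fun j hj x hx => ?_, fun x hx y hy => ?_⟩
  · rw [hadd j hj]
    exact (norm_add_le _ _).trans (add_le_add (h.norm_le j hj x hx) (h'.norm_le j hj x hx))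
  · rw [hadd s le_rfl, hadd s le_rfl, add_sub_add_comm, add_mul]
    exact (norm_add_le _ _).trans (add_le_add (h.norm_sub_le x hx y hy) (h'.norm_sub_le x hx y hy))

theorem clm_comp (h : HolderBoundOn s α A B f) {L : F →L[ℝ] G} {C : ℝ} (hL : ‖L‖ ≤ C) :
    HolderBoundOn s α A (C * B) (L ∘ f) := by
  have hC : 0 ≤ C := (norm_nonneg L).trans hL
  have hcomp : ∀ j ≤ s, ∀ x, iteratedFDeriv ℝ j (L ∘ f) x =
      L.compContinuousMultilinearMap (iteratedFDeriv ℝ j f x) := fun j hj x =>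
    L.iteratedFDeriv_comp_left h.contDiff.contDiffAt (by exact_mod_cast hj)
  refine ⟨L.contDiff.comp h.contDiff, fun j hj x hx => ?_, fun x hx y hy => ?_⟩
  · rw [hcomp j hj]
    exact (L.norm_compContinuousMultilinearMap_le _).trans
      (mul_le_mul hL (h.norm_le j hj x hx) (norm_nonneg _) hC)
  · have hsub : iteratedFDeriv ℝ s (L ∘ f) x - iteratedFDeriv ℝ s (L ∘ f) y =
        L.compContinuousMultilinearMap (iteratedFDeriv ℝ s f x - iteratedFDeriv ℝ s f y) := by
      rw [hcomp s le_rfl, hcomp s le_rfl]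
      ext
      simp
    rw [hsub, mul_assoc]
    exact (L.norm_compContinuousMultilinearMap_le _).trans
      (mul_le_mul hL (h.norm_sub_le x hx y hy) (norm_nonneg _) hC)

theorem of_derivative_bounds (hA : Convex ℝ A) (hα0 : 0 ≤ α) (hα1 : α ≤ 1) {h M : ℝ} (hh : 0 < h)
    (hh1 : h ≤ 1) (hM : 0 ≤ M) (hf : ContDiff ℝ (s + 1 : ℕ) f)
    (hb : ∀ j ≤ s + 1, ∀ x ∈ A, ‖iteratedFDeriv ℝ j f x‖ ≤ M * h ^ (-(j : ℝ))) :
    HolderBoundOn s α A (2 * (M * h ^ (-(s + α)))) f := by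
  refine ⟨hf.of_le (by exact_mod_cast Nat.le_succ s), fun j hj x hx => ?_, fun x hx y hy => ?_⟩
  · have hpow : h ^ (-(j : ℝ)) ≤ h ^ (-(s + α)) := by
      have : (j : ℝ) ≤ s := by exact_mod_cast hj
      exact Real.rpow_le_rpow_of_exponent_ge hh hh1 (by linarith)
    calc ‖iteratedFDeriv ℝ j f x‖ ≤ M * h ^ (-(j : ℝ)) := hb j (by lia) x hx
      _ ≤ M * h ^ (-(s + α)) := by gcongr
      _ ≤ 2 * (M * h ^ (-(s + α))) := le_mul_of_one_le_left (by positivity) one_le_two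
  · have hs : Differentiable ℝ (iteratedFDeriv ℝ s f) :=
      hf.differentiable_iteratedFDeriv (by exact_mod_cast Nat.lt_succ_self s)
    refine (norm_sub_le_of_fderiv_le hA hα0 hα1 hh hs (hb s (by lia)) (fun z hz => ?_) hx
      hy).trans_eq ?_
    · rw [norm_fderiv_iteratedFDeriv]
      refine (hb _ le_rfl z hz).trans_eq ?_
      rw [Nat.cast_succ, neg_add, Real.rpow_add hh, Real.rpow_neg_one]
      ring
    · rw [neg_add, Real.rpow_add hh, Real.rpow_neg hh.le α, Real.div_rpow (norm_nonneg _) hh.le]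
      ring

theorem exists_of_contDiff (hA : Convex ℝ A) (hAc : IsCompact A) (hα0 : 0 ≤ α) (hα1 : α ≤ 1)
    (hf : ContDiff ℝ (s + 1 : ℕ) f) : ∃ B, HolderBoundOn s α A B f := by
  have hbound : ∀ j ∈ Set.Iic (s + 1), ∀ᶠ M in Filter.atTop,
      ∀ x ∈ A, ‖iteratedFDeriv ℝ j f x‖ ≤ M := fun j hj => by
    obtain ⟨M, hM⟩ := hAc.exists_bound_of_continuousOn
      (hf.continuous_iteratedFDeriv (m := j) (by exact_mod_cast hj)).continuousOn
    exact Filter.eventually_atTop.2 ⟨M, fun M' hM' x hx => (hM x hx).trans hM'⟩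
  obtain ⟨M, hM, hM0⟩ := (((Set.finite_Iic (s + 1)).eventually_all.2 hbound).and
    (Filter.eventually_ge_atTop 0)).exists
  refine ⟨_, of_derivative_bounds hA hα0 hα1 one_pos le_rfl hM0 hf fun j hj x hx => ?_⟩
  rw [Real.one_rpow, mul_one]
  exact hM j hj x hx

end NormedSpace

variable {d : ℕ} {β K B : ℝ} {A : Set (EuclideanSpace ℝ (Fin d))}

theorem mem_holderBall {f : EuclideanSpace ℝ (Fin d) → ℝ}
    (h : HolderBoundOn (holderOrder β) (β - holderOrder β) A B f) (hK : 2 * B ≤ K) :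
    f ∈ holderBall β K A := by
  have hpartial : ∀ {j : ℕ} (i : Fin j → Fin d)
      (L : ContinuousMultilinearMap ℝ (fun _ : Fin j => EuclideanSpace ℝ (Fin d)) ℝ),
      |L fun l => EuclideanSpace.single (i l) (1 : ℝ)| ≤ ‖L‖ := fun i L => by
    simpa using L.le_opNorm fun l => EuclideanSpace.single (i l) (1 : ℝ)
  refine ⟨h.contDiff.continuous.continuousOn, h.contDiff.contDiffOn, ?_⟩
  calc holderNorm β A f ≤ ENNReal.ofReal B + ENNReal.ofReal B := by
        refine add_le_add (iSup₂_le fun j hj => iSup_le fun i => iSup₂_le fun x hx => ?_)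
          (iSup_le fun i => iSup₂_le fun x hx => iSup₂_le fun y hy => iSup_le fun hxy => ?_)
        · exact ENNReal.ofReal_le_ofReal
            ((hpartial i _).trans (h.norm_le j hj x (interior_subset hx)))
        · refine ENNReal.ofReal_le_ofReal ?_
          have hpos : 0 < ‖x - y‖ := norm_pos_iff.2 (sub_ne_zero.2 hxy)
          rw [div_le_iff₀ (Real.rpow_pos_of_pos hpos _)]
          refine le_trans ?_ (h.norm_sub_le x (interior_subset hx) y (interior_subset hy))
          exact hpartial i (iteratedFDeriv ℝ (holderOrder β) f x - iteratedFDeriv ℝ _ f y)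
    _ = ENNReal.ofReal (2 * B) := by
        rw [← two_mul, ENNReal.ofReal_mul zero_le_two, ENNReal.ofReal_ofNat]
    _ ≤ ENNReal.ofReal K := ENNReal.ofReal_le_ofReal hK

theorem mem_generatorClass {D : ℕ} {g : EuclideanSpace ℝ (Fin d) → EuclideanSpace ℝ (Fin D)}
    (h : HolderBoundOn (holderOrder β) (β - holderOrder β) (unitCube d) B g) (hK : 2 * B ≤ K) :
    g ∈ generatorClass d D β K := fun i => by
  have hproj : ‖(PiLp.proj 2 (fun _ : Fin D => ℝ) i : EuclideanSpace ℝ (Fin D) →L[ℝ] ℝ)‖ ≤ 1 :=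
    ContinuousLinearMap.opNorm_le_bound _ zero_le_one fun x => by
      rw [one_mul]; exact PiLp.norm_apply_le x i
  exact mem_holderBall (h.clm_comp hproj) (by rwa [one_mul])

end HolderBoundOn

theorem holderOrder_lt {β : ℝ} (hβ : 0 < β) : (holderOrder β : ℝ) < β := by
  have h1 : 1 ≤ ⌈β⌉₊ := Nat.ceil_pos.2 hβ
  rw [holderOrder, Nat.cast_sub h1, Nat.cast_one]
  linarith [Nat.ceil_lt_add_one hβ.le]

theorem sub_holderOrder_le_one (β : ℝ) : β - holderOrder β ≤ 1 := by
  have : (⌈β⌉₊ : ℝ) ≤ (⌈β⌉₊ - 1 : ℕ) + 1 := by exact_mod_cast Nat.le_add_of_sub_le le_rfl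
  rw [holderOrder]
  linarith [Nat.le_ceil β]

/-! ### Bumps and shears -/

theorem norm_inv_smul_sub {E : Type*} [SeminormedAddCommGroup E] [NormedSpace ℝ E] {h : ℝ}
    (hh : 0 < h) (z c : E) : ‖h⁻¹ • (z - c)‖ = dist z c / h := by
  rw [norm_smul, norm_inv, Real.norm_of_nonneg hh.le, ← dist_eq_norm, inv_mul_eq_div]

section Bump

variable (E : Type*) [NormedAddCommGroup E] [NormedSpace ℝ E] [HasContDiffBump E]

/-- The reference bump. Its support has radius `1 / 16`, so that a shear that moves points by at
most `1 / 16` keeps it in the ball of radius `1 / 8`, where `cellTest` is affine. -/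
def unitBump : ContDiffBump (0 : E) where
  rIn := 1 / 32
  rOut := 1 / 16
  rIn_pos := by norm_num
  rIn_lt_rOut := by norm_num

variable {E}

theorem unitBump_eq_zero {u : E} (hu : 1 / 16 ≤ ‖u‖) : unitBump E u = 0 :=
  (unitBump E).zero_of_le_dist (by rwa [dist_zero_right])

theorem fderiv_unitBump_eq_zero {u : E} (hu : 1 / 16 < ‖u‖) :
    fderiv ℝ (unitBump E) u = 0 := by
  refine image_eq_zero_of_notMem_tsupport fun hmem => hu.not_ge ?_
  have hball := tsupport_fderiv_subset ℝ hmem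
  rwa [(unitBump E).tsupport_eq, mem_closedBall_zero_iff] at hball

theorem exists_bound_iteratedFDeriv_unitBump [FiniteDimensional ℝ E] (k : ℕ) :
    ∃ B, 0 ≤ B ∧ ∀ j ≤ k, ∀ x, ‖iteratedFDeriv ℝ j (unitBump E) x‖ ≤ B := by
  have hbound : ∀ j ∈ Set.Iic k, ∀ᶠ B in Filter.atTop,
      ∀ x, ‖iteratedFDeriv ℝ j (unitBump E) x‖ ≤ B := fun j _ => by
    obtain ⟨M, hM⟩ := ((unitBump E).contDiff.continuous_iteratedFDeriv (n := j)
      le_rfl).bounded_above_of_compact_support ((unitBump E).hasCompactSupport.iteratedFDeriv j)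
    exact Filter.eventually_atTop.2 ⟨M, fun M' hM' x => (hM x).trans hM'⟩
  exact ((Filter.eventually_ge_atTop 0).and
    ((Set.finite_Iic k).eventually_all.2 hbound)).exists

/-- The reference bump transported to the cell of side `h` with centre `c`. Its height is `a * h`,
so that its slope is of order `a`. -/
def cellBump (a h : ℝ) (c z : E) : ℝ :=
  a * h * unitBump E (h⁻¹ • (z - c))

variable {a h : ℝ} (c : E)

theorem contDiff_cellBump {n : ℕ∞} : ContDiff ℝ n (cellBump a h c) :=
  contDiff_const.mul ((unitBump E).contDiff.comp
    (g := unitBump E) (f := fun z => h⁻¹ • (z - c)) (by fun_prop))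

theorem cellBump_nonneg (ha : 0 ≤ a) (hh : 0 ≤ h) (z : E) : 0 ≤ cellBump a h c z :=
  mul_nonneg (mul_nonneg ha hh) (unitBump E).nonneg

theorem cellBump_le (ha : 0 ≤ a) (hh : 0 ≤ h) (z : E) : cellBump a h c z ≤ a * h :=
  mul_le_of_le_one_right (mul_nonneg ha hh) (unitBump E).le_one

theorem cellBump_eq_zero (hh : 0 < h) {z : E} (hz : h / 16 ≤ dist z c) : cellBump a h c z = 0 := by
  rw [cellBump, unitBump_eq_zero, mul_zero]
  rw [norm_inv_smul_sub hh, le_div_iff₀ hh]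
  linarith

theorem tsupport_cellBump_subset (hh : 0 < h) :
    tsupport (cellBump a h c) ⊆ Metric.closedBall c (h / 16) :=
  closure_minimal (fun _ hz => Metric.mem_closedBall.2 <| le_of_not_ge fun hzc =>
    hz (cellBump_eq_zero c hh hzc)) Metric.isClosed_closedBall

theorem iteratedFDeriv_cellBump (j : ℕ) (z : E) :
    iteratedFDeriv ℝ j (cellBump a h c) z =
      (a * h * h⁻¹ ^ j) • iteratedFDeriv ℝ j (unitBump E) (h⁻¹ • (z - c)) := by
  have hfun : cellBump a h c = (a * h) • fun z => unitBump E (h⁻¹ • (z - c)) := rfl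
  have hsmooth : ContDiff ℝ j fun z => unitBump E (h⁻¹ • (z - c)) :=
    (unitBump E).contDiff.comp (g := unitBump E) (f := fun z => h⁻¹ • (z - c)) (by fun_prop)
  rw [hfun, iteratedFDeriv_const_smul_apply hsmooth.contDiffAt,
    iteratedFDeriv_comp_sub (f := fun u => unitBump E (h⁻¹ • u)),
    iteratedFDeriv_comp_const_smul _ (unitBump E).contDiff, smul_smul]

theorem norm_iteratedFDeriv_cellBump_le (ha : 0 ≤ a) (hh : 0 < h) {B : ℝ} {j : ℕ}
    (hB : ∀ x, ‖iteratedFDeriv ℝ j (unitBump E) x‖ ≤ B) (z : E) :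
    ‖iteratedFDeriv ℝ j (cellBump a h c) z‖ ≤ a * h * B * h ^ (-(j : ℝ)) := by
  have hpow : h⁻¹ ^ j = h ^ (-(j : ℝ)) := by
    rw [Real.rpow_neg hh.le, Real.rpow_natCast, inv_pow]
  rw [iteratedFDeriv_cellBump, norm_smul, Real.norm_of_nonneg (by positivity), hpow,
    mul_right_comm (a * h)]
  gcongr
  exact hB _

theorem fderiv_cellBump (hh : h ≠ 0) (z : E) :
    fderiv ℝ (cellBump a h c) z = a • fderiv ℝ (unitBump E) (h⁻¹ • (z - c)) := by
  have hinner : HasFDerivAt (fun z => h⁻¹ • (z - c)) (h⁻¹ • ContinuousLinearMap.id ℝ E) z :=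
    ((hasFDerivAt_id z).sub_const c).const_smul h⁻¹
  have houter : HasFDerivAt (unitBump E) (fderiv ℝ (unitBump E) (h⁻¹ • (z - c)))
      (h⁻¹ • (z - c)) :=
    (((unitBump E).contDiff (n := 1)).differentiable one_ne_zero _).hasFDerivAt
  refine ((houter.comp z hinner).const_mul (a * h)).fderiv.trans ?_
  rw [ContinuousLinearMap.comp_smul, ContinuousLinearMap.comp_id, smul_smul, mul_assoc,
    mul_inv_cancel₀ hh, mul_one]

theorem norm_fderiv_cellBump_le (ha : 0 ≤ a) (hh : h ≠ 0) {B : ℝ}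
    (hB : ∀ x, ‖fderiv ℝ (unitBump E) x‖ ≤ B) (z : E) :
    ‖fderiv ℝ (cellBump a h c) z‖ ≤ a * B := by
  rw [fderiv_cellBump c hh, norm_smul, Real.norm_of_nonneg ha]
  exact mul_le_mul_of_nonneg_left (hB _) ha

end Bump

section SumOfDisjoint

variable {ι E F : Type*} [NormedAddCommGroup E] [NormedSpace ℝ E] [NormedAddCommGroup F]
  [NormedSpace ℝ F]

theorem norm_iteratedFDeriv_sum_le {s : Finset ι} {f : ι → E → F} {k : ℕ}
    (hf : ∀ j ∈ s, ContDiff ℝ k (f j))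
    (hdisj : (s : Set ι).PairwiseDisjoint fun j => tsupport (f j)) {M : ℝ} (hM : 0 ≤ M)
    (hb : ∀ j ∈ s, ∀ x, ‖iteratedFDeriv ℝ k (f j) x‖ ≤ M) (x : E) :
    ‖iteratedFDeriv ℝ k (fun z => ∑ j ∈ s, f j z) x‖ ≤ M := by
  have hzero : ∀ j, x ∉ tsupport (f j) → iteratedFDeriv ℝ k (f j) x = 0 := fun j hx =>
    by_contra fun hne => hx (support_iteratedFDeriv_subset k hne)
  rw [iteratedFDeriv_fun_sum_apply fun j hj => (hf j hj).contDiffAt]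
  by_cases hx : ∃ i ∈ s, x ∈ tsupport (f i)
  · obtain ⟨i, hi, hxi⟩ := hx
    rw [Finset.sum_eq_single_of_mem i hi fun j hj hji => hzero j fun hxj =>
      Set.disjoint_left.1 (hdisj hj hi hji) hxj hxi]
    exact hb i hi x
  · push Not at hx
    rw [Finset.sum_eq_zero fun j hj => hzero j (hx j hj), norm_zero]
    exact hM

end SumOfDisjoint

section Shear

variable {E : Type*} [NormedAddCommGroup E] [NormedSpace ℝ E] {F : E → ℝ} {v : E}

/-- The shear in the direction `v` with profile `F`, a nonlinear version of
`LinearMap.transvection`. -/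
def shear (F : E → ℝ) (v z : E) : E :=
  z + F z • v

theorem continuous_shear (hF : Continuous F) : Continuous (shear F v) :=
  continuous_id.add (hF.smul continuous_const)

theorem HolderBoundOn.shear {s : ℕ} {α : ℝ} {A : Set E} {B₀ B : ℝ}
    (hid : HolderBoundOn s α A B₀ id) (hF : HolderBoundOn s α A B F) (hv : ‖v‖ ≤ 1) :
    HolderBoundOn s α A (B₀ + B) (shear F v) := by
  have hline := hF.clm_comp (L := ContinuousLinearMap.toSpanSingleton ℝ v) (C := 1)
    ((ContinuousLinearMap.norm_toSpanSingleton v).trans_le hv)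
  rw [one_mul] at hline
  exact hid.add hline

theorem bijective_shear [CompleteSpace E] {k : NNReal} (hF : LipschitzWith k F)
    (hk : k * ‖v‖₊ < 1) : Function.Bijective (shear F v) := by
  have happrox : ApproximatesLinearOn (shear F v)
      (ContinuousLinearEquiv.refl ℝ E : E →L[ℝ] E) Set.univ (k * ‖v‖₊) := fun x _ y _ => by
    have hsub : shear F v x - shear F v y - (x - y) = (F x - F y) • v := by
      rw [shear, shear, sub_smul]
      abel
    rw [ContinuousLinearEquiv.coe_refl, ContinuousLinearMap.id_apply, hsub, norm_smul,
      NNReal.coe_mul, coe_nnnorm, mul_right_comm]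
    gcongr
    exact hF.norm_sub_le x y
  have hc : Subsingleton E ∨
      k * ‖v‖₊ < ‖((ContinuousLinearEquiv.refl ℝ E).symm : E →L[ℝ] E)‖₊⁻¹ := by
    rcases subsingleton_or_nontrivial E with hE | hE
    · exact .inl hE
    · right
      rwa [ContinuousLinearEquiv.refl_symm, ContinuousLinearEquiv.coe_refl,
        ContinuousLinearMap.nnnorm_id, inv_one]
  exact ⟨Set.injOn_univ.1 (happrox.injOn hc), happrox.surjective hc⟩

variable [FiniteDimensional ℝ E] [MeasurableSpace E] [BorelSpace E]

theorem map_withDensity_shear {μ : Measure E} [μ.IsAddHaarMeasure] {k : NNReal}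
    (hF : LipschitzWith k F) (hdiff : Differentiable ℝ F) (hk : k * ‖v‖₊ < 1) {A : Set E}
    (hA : MeasurableSet A) (hinv : shear F v ⁻¹' A = A) :
    ((μ.restrict A).withDensity fun z => ENNReal.ofReal (1 + fderiv ℝ F z v)).map (shear F v) =
      μ.restrict A := by
  have hbij := bijective_shear hF hk
  have himage : shear F v '' A = A := by
    conv_lhs => rw [← hinv]
    exact Set.image_preimage_eq A hbij.surjective
  have hderiv : ∀ z, HasFDerivAt (shear F v)
      (ContinuousLinearMap.id ℝ E + (fderiv ℝ F z).smulRight v) z := fun z =>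
    (hasFDerivAt_id z).add ((hdiff z).hasFDerivAt.smul_const v)
  have hdet : ∀ z, |(ContinuousLinearMap.id ℝ E + (fderiv ℝ F z).smulRight v).det| =
      1 + fderiv ℝ F z v := fun z => by
    have hle : |fderiv ℝ F z v| ≤ 1 :=
      ((fderiv ℝ F z).le_opNorm v).trans <| (mul_le_mul_of_nonneg_right
        (norm_fderiv_le_of_lipschitz ℝ hF) (norm_nonneg v)).trans (by exact_mod_cast hk.le)
    have htransvection : (ContinuousLinearMap.id ℝ E + (fderiv ℝ F z).smulRight v).det =
        1 + fderiv ℝ F z v := LinearMap.transvection.det (fderiv ℝ F z : E →ₗ[ℝ] ℝ) v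
    rw [htransvection, abs_of_nonneg (by linarith [(abs_le.1 hle).1])]
  have hchange := map_withDensity_abs_det_fderiv_eq_addHaar μ hA.nullMeasurableSet
    (fun z _ => (hderiv z).hasFDerivWithinAt) hbij.injective.injOn
  simp_rw [hdet, himage] at hchange
  exact hchange

end Shear

/-! ### Bumps on separated cells -/

theorem eq_of_dist_lt_half {X ι : Type*} [PseudoMetricSpace X] {c : ι → X} {h : ℝ}
    (hc : Pairwise fun i j => h ≤ dist (c i) (c j)) {z : X} {i j : ι}
    (hi : dist z (c i) < h / 2) (hj : dist z (c j) ≤ h / 2) : i = j := by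
  by_contra hne
  linarith [hc hne, dist_triangle_left (c i) (c j) z]

section NormedSpace

variable {E : Type*} [NormedAddCommGroup E] [NormedSpace ℝ E] [HasContDiffBump E] {a h : ℝ} {v : E}

theorem dist_shear_cellBump_le (ha : 0 ≤ a) (hh : 0 ≤ h) (hv : ‖v‖ ≤ 1) (c z : E) :
    dist (shear (cellBump a h c) v z) z ≤ a * h := by
  rw [dist_eq_norm, shear, add_sub_cancel_left, norm_smul,
    Real.norm_of_nonneg (cellBump_nonneg c ha hh z)]
  exact (mul_le_of_le_one_right (cellBump_nonneg c ha hh z) hv).trans (cellBump_le c ha hh z)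

theorem dist_shear_cellBump_le_of_dist_le (ha : 0 ≤ a) (ha' : a ≤ 1 / 16) (hh : 0 ≤ h)
    (hv : ‖v‖ ≤ 1) {c z : E} (hz : dist z c ≤ h / 16) :
    dist (shear (cellBump a h c) v z) c ≤ h / 8 := by
  have hah : a * h ≤ h / 16 := by nlinarith
  linarith [dist_triangle (shear (cellBump a h c) v z) z c, dist_shear_cellBump_le ha hh hv c z]

theorem shear_cellBump_of_le_dist (hh : 0 < h) {c z : E} (hz : h / 16 ≤ dist z c) :
    shear (cellBump a h c) v z = z := by
  rw [shear, cellBump_eq_zero c hh hz, zero_smul, add_zero]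

theorem shear_cellBump_preimage (ha : 0 ≤ a) (ha' : a ≤ 1 / 16) (hh : 0 < h) (hv : ‖v‖ ≤ 1) {c : E}
    {A : Set E} (hA : Metric.ball c (h / 2) ⊆ A) : shear (cellBump a h c) v ⁻¹' A = A := by
  ext z
  rcases le_total (h / 16) (dist z c) with hz | hz
  · rw [Set.mem_preimage, shear_cellBump_of_le_dist hh hz]
  · have hmove := dist_shear_cellBump_le_of_dist_le ha ha' hh.le hv hz
    exact iff_of_true (hA (Metric.mem_ball.2 (by linarith)))
      (hA (Metric.mem_ball.2 (by linarith)))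

/-- The sum of the bumps on the cells selected by `s`. -/
def bumpSum {ι : Type*} (a h : ℝ) (c : ι → E) (s : Finset ι) (z : E) : ℝ :=
  ∑ j ∈ s, cellBump a h (c j) z

variable {ι : Type*} {c : ι → E} {s : Finset ι}

theorem contDiff_bumpSum {n : ℕ∞} : ContDiff ℝ n (bumpSum a h c s) :=
  ContDiff.sum fun j _ => contDiff_cellBump (c j)

theorem bumpSum_insert [DecidableEq ι] {j : ι} (hj : j ∉ s) (z : E) :
    bumpSum a h c (insert j s) z = cellBump a h (c j) z + bumpSum a h c s z :=
  Finset.sum_insert hj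

theorem bumpSum_eq_zero (hh : 0 < h) (hc : Pairwise fun i j => h ≤ dist (c i) (c j)) {j : ι}
    (hj : j ∉ s) {z : E} (hz : dist z (c j) < h / 2) : bumpSum a h c s z = 0 :=
  Finset.sum_eq_zero fun k hk => cellBump_eq_zero (c k) hh <| le_of_not_gt fun hlt =>
    hj (eq_of_dist_lt_half hc hz (by linarith : dist z (c k) ≤ h / 2) ▸ hk)

theorem bumpSum_shear_cellBump (ha : 0 ≤ a) (ha' : a ≤ 1 / 16) (hh : 0 < h) (hv : ‖v‖ ≤ 1)
    (hc : Pairwise fun i j => h ≤ dist (c i) (c j)) {j : ι} (hj : j ∉ s) (z : E) :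
    bumpSum a h c s (shear (cellBump a h (c j)) v z) = bumpSum a h c s z := by
  rcases le_total (h / 16) (dist z (c j)) with hz | hz
  · rw [shear_cellBump_of_le_dist hh hz]
  · have hmove := dist_shear_cellBump_le_of_dist_le ha ha' hh.le hv hz
    rw [bumpSum_eq_zero hh hc hj (by linarith), bumpSum_eq_zero hh hc hj (by linarith)]

theorem shear_bumpSum_comp_shear_cellBump [DecidableEq ι] (ha : 0 ≤ a) (ha' : a ≤ 1 / 16)
    (hh : 0 < h) (hv : ‖v‖ ≤ 1) (hc : Pairwise fun i j => h ≤ dist (c i) (c j)) {j : ι}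
    (hj : j ∉ s) :
    shear (bumpSum a h c s) v ∘ shear (cellBump a h (c j)) v =
      shear (bumpSum a h c (insert j s)) v := by
  ext1 z
  rw [Function.comp_apply, shear, bumpSum_shear_cellBump ha ha' hh hv hc hj, shear, shear,
    bumpSum_insert hj, add_smul, add_assoc]

theorem holderBoundOn_bumpSum (ha : 0 ≤ a) (hh : 0 < h) (hh1 : h ≤ 1)
    (hc : Pairwise fun i j => h ≤ dist (c i) (c j)) {k : ℕ} {α : ℝ} (hα0 : 0 ≤ α) (hα1 : α ≤ 1)
    {B : ℝ} (hB0 : 0 ≤ B) (hB : ∀ j ≤ k + 1, ∀ x, ‖iteratedFDeriv ℝ j (unitBump E) x‖ ≤ B)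
    {A : Set E} (hA : Convex ℝ A) :
    HolderBoundOn k α A (2 * (a * h * B * h ^ (-(k + α)))) (bumpSum a h c s) := by
  have hdisj : (s : Set ι).PairwiseDisjoint fun j => tsupport (cellBump a h (c j)) :=
    fun i _ j _ hij => Set.disjoint_left.2 fun z hi hj => hij <| eq_of_dist_lt_half hc (z := z)
      (by linarith [Metric.mem_closedBall.1 (tsupport_cellBump_subset (c i) hh hi)])
      (by linarith [Metric.mem_closedBall.1 (tsupport_cellBump_subset (c j) hh hj)])
  exact HolderBoundOn.of_derivative_bounds hA hα0 hα1 hh hh1 (by positivity)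
    (contDiff_bumpSum (n := (k + 1 : ℕ))) fun j hj x _ =>
      norm_iteratedFDeriv_sum_le (fun i _ => contDiff_cellBump (n := j) (c i)) hdisj
        (by positivity) (fun i _ z => norm_iteratedFDeriv_cellBump_le (c i) ha hh (hB j hj) z) x

end NormedSpace

section InnerProductSpace

open scoped RealInnerProductSpace

variable {E : Type*} [NormedAddCommGroup E] [InnerProductSpace ℝ E] {a h : ℝ} {v : E}

/-- The test function of the cell of side `h` with centre `c`. It is affine with slope one in the
direction `v` near `c` and vanishes outside the ball of radius `h / 2`. -/
def cellTest (v : E) (h : ℝ) (c z : E) : ℝ :=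
  max 0 (min (⟪v, z - c⟫ + h / 8) (h / 2 - dist z c))

theorem abs_cellTest_le (hh : 0 ≤ h) (c z : E) : |cellTest v h c z| ≤ h := by
  rw [abs_of_nonneg (le_max_left _ _)]
  exact max_le hh ((min_le_right _ _).trans (by linarith [dist_nonneg (x := z) (y := c)]))

theorem cellTest_of_le_dist {c z : E} (hz : h / 2 ≤ dist z c) : cellTest v h c z = 0 :=
  max_eq_left ((min_le_right _ _).trans (by linarith))

theorem cellTest_of_dist_le (hv : ‖v‖ ≤ 1) {c z : E} (hz : dist z c ≤ h / 8) :
    cellTest v h c z = ⟪v, z - c⟫ + h / 8 := by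
  have hinner : |⟪v, z - c⟫| ≤ dist z c := by
    rw [dist_eq_norm]
    exact (abs_real_inner_le_norm _ _).trans (mul_le_of_le_one_left (norm_nonneg _) hv)
  obtain ⟨hl, hu⟩ := abs_le.1 hinner
  rw [cellTest, min_eq_left (by linarith), max_eq_right (by linarith)]

theorem lipschitzWith_cellTest (hv : ‖v‖ ≤ 1) (c : E) : LipschitzWith 1 (cellTest v h c) := by
  have hinner : LipschitzWith 1 fun z => ⟪v, z - c⟫ + h / 8 :=
    LipschitzWith.of_dist_le_mul fun x y => by
      rw [dist_add_right, Real.dist_eq, ← inner_sub_right, sub_sub_sub_cancel_right,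
        NNReal.coe_one, dist_eq_norm]
      exact (abs_real_inner_le_norm _ _).trans (by gcongr)
  have hdist : LipschitzWith 1 fun z => h / 2 - dist z c :=
    LipschitzWith.of_dist_le_mul fun x y => by
      rw [dist_sub_left, NNReal.coe_one, one_mul]
      exact abs_dist_sub_le x y c
  have htest := (hinner.min hdist).const_max 0
  rw [max_self] at htest
  exact htest

theorem disjoint_support_cellTest {ι : Type*} {c : ι → E}
    (hc : Pairwise fun i j => h ≤ dist (c i) (c j)) :
    Pairwise fun i j =>
      Disjoint (Function.support (cellTest v h (c i))) (Function.support (cellTest v h (c j))) :=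
  fun i j hij => Set.disjoint_left.2 fun z hi hj => by
    have hnear : ∀ k, cellTest v h (c k) z ≠ 0 → dist z (c k) < h / 2 := fun k hk =>
      lt_of_not_ge fun hge => hk (cellTest_of_le_dist hge)
    exact hij (eq_of_dist_lt_half hc (hnear i hi) (hnear j hj).le)

theorem cellTest_map {E' : Type*} [NormedAddCommGroup E'] [InnerProductSpace ℝ E']
    (L : E →ₗᵢ[ℝ] E') (c z : E) : cellTest (L v) h (L c) (L z) = cellTest v h c z := by
  rw [cellTest, cellTest, ← map_sub, L.inner_map_map, L.dist_map]

theorem cellTest_shear_bumpSum_insert {ι : Type*} [DecidableEq ι] {c : ι → E} {s : Finset ι}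
    (ha : 0 ≤ a) (ha' : a ≤ 1 / 16) (hh : 0 < h) (hv : ‖v‖ = 1)
    (hc : Pairwise fun i j => h ≤ dist (c i) (c j)) {j : ι} (hj : j ∉ s) (z : E) :
    cellTest v h (c j) (shear (bumpSum a h c (insert j s)) v z) =
      cellTest v h (c j) (shear (bumpSum a h c s) v z) + cellBump a h (c j) z := by
  rcases le_total (h / 16) (dist z (c j)) with hz | hz
  · rw [shear, bumpSum_insert hj, cellBump_eq_zero (c j) hh hz, zero_add, add_zero, shear]
  · have hmove := dist_shear_cellBump_le_of_dist_le ha ha' hh.le hv.le hz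
    have hs : bumpSum a h c s z = 0 := bumpSum_eq_zero hh hc hj (by linarith)
    have hinsert : shear (bumpSum a h c (insert j s)) v z = shear (cellBump a h (c j)) v z := by
      rw [shear, bumpSum_insert hj, hs, add_zero, shear]
    rw [hinsert, cellTest_of_dist_le hv.le hmove, shear, shear, hs, zero_smul, add_zero,
      cellTest_of_dist_le hv.le (by linarith), add_sub_right_comm, inner_add_right,
      real_inner_smul_self_right, hv]
    ring

end InnerProductSpace

/-! ### The unit cube and its cells -/

section UnitCube

theorem unitCube_eq_preimage (d : ℕ) :
    unitCube d = (WithLp.ofLp : EuclideanSpace ℝ (Fin d) → Fin d → ℝ) ⁻¹' Set.Icc 0 1 := by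
  ext z
  simp [unitCube, Pi.le_def, forall_and]

theorem isCompact_unitCube (d : ℕ) : IsCompact (unitCube d) := by
  rw [unitCube_eq_preimage]
  exact (EuclideanSpace.equiv (Fin d) ℝ).toHomeomorph.isCompact_preimage.2 isCompact_Icc

theorem convex_unitCube (d : ℕ) : Convex ℝ (unitCube d) := by
  rw [unitCube_eq_preimage]
  exact (convex_Icc 0 1).linear_preimage (EuclideanSpace.equiv (Fin d) ℝ).toLinearMap

theorem measurableSet_unitCube (d : ℕ) : MeasurableSet (unitCube d) :=
  (isCompact_unitCube d).measurableSet

instance isProbabilityMeasure_uniformCube (d : ℕ) : IsProbabilityMeasure (uniformCube d) := by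
  constructor
  rw [uniformCube, Measure.restrict_apply_univ, unitCube_eq_preimage,
    (PiLp.volume_preserving_ofLp (Fin d)).measure_preimage measurableSet_Icc.nullMeasurableSet,
    Real.volume_Icc_pi]
  simp

end UnitCube

section Grid

variable {d m : ℕ}

/-- The centres of the cells of the regular grid with `m ^ d` cells in the unit cube. -/
def gridCentre (j : Fin d → Fin m) : EuclideanSpace ℝ (Fin d) :=
  WithLp.toLp 2 fun i => ((j i : ℝ) + 1 / 2) * (m : ℝ)⁻¹

theorem le_dist_gridCentre :
    Pairwise fun j k : Fin d → Fin m => (m : ℝ)⁻¹ ≤ dist (gridCentre j) (gridCentre k) := by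
  intro j k hjk
  obtain ⟨i, hi⟩ := Function.ne_iff.1 hjk
  have hint : ((j i : ℕ) : ℤ) - (k i : ℕ) ≠ 0 :=
    sub_ne_zero.2 (Nat.cast_injective.ne (Fin.val_ne_of_ne hi))
  have hgap : (1 : ℝ) ≤ |(j i : ℝ) - k i| := by exact_mod_cast Int.one_le_abs hint
  calc (m : ℝ)⁻¹ ≤ |(j i : ℝ) - k i| * (m : ℝ)⁻¹ := le_mul_of_one_le_left (by positivity) hgap
    _ = ‖(gridCentre j - gridCentre k) i‖ := by
        rw [Real.norm_eq_abs, PiLp.sub_apply, gridCentre, gridCentre, ← sub_mul,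
          add_sub_add_right_eq_sub, abs_mul, abs_of_nonneg (by positivity : (0 : ℝ) ≤ (m : ℝ)⁻¹)]
    _ ≤ dist (gridCentre j) (gridCentre k) := by
        rw [dist_eq_norm]
        exact PiLp.norm_apply_le _ i

theorem ball_gridCentre_subset (j : Fin d → Fin m) :
    Metric.ball (gridCentre j) ((m : ℝ)⁻¹ / 2) ⊆ unitCube d := by
  intro z hz i
  have hm : (0 : ℝ) < m := by exact_mod_cast (Nat.zero_le _).trans_lt (j i).2
  have hlast : ((j i : ℝ) + 1) * (m : ℝ)⁻¹ ≤ 1 := by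
    rw [← div_eq_mul_inv, div_le_one hm]
    exact_mod_cast (j i).2
  have hfirst : 0 ≤ (j i : ℝ) * (m : ℝ)⁻¹ := by positivity
  have hcoord : |z i - ((j i : ℝ) + 1 / 2) * (m : ℝ)⁻¹| < (m : ℝ)⁻¹ / 2 :=
    (PiLp.norm_apply_le (z - gridCentre j) i).trans_lt (by rwa [← dist_eq_norm])
  rw [abs_lt] at hcoord
  constructor <;> linarith

end Grid

/-! ### Affinity of samples that differ in one bump -/

section Integral

variable {E : Type*} [NormedAddCommGroup E] [NormedSpace ℝ E] [FiniteDimensional ℝ E]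
  [MeasurableSpace E] [BorelSpace E] {μ : Measure E} [μ.IsAddHaarMeasure] {a h : ℝ} {c : E}
  {A : Set E}

theorem setIntegral_comp_inv_smul_sub {F : Type*} [NormedAddCommGroup F] [NormedSpace ℝ F]
    (hh : 0 < h) (hA : Metric.ball c (h / 2) ⊆ A) {G : E → F} (hG : ∀ u, 1 / 2 ≤ ‖u‖ → G u = 0) :
    ∫ z in A, G (h⁻¹ • (z - c)) ∂μ = h ^ Module.finrank ℝ E • ∫ u, G u ∂μ := by
  rw [setIntegral_eq_integral_of_forall_compl_eq_zero fun z hz => hG _ ?_,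
    integral_sub_right_eq_self (fun z => G (h⁻¹ • z)) c, Measure.integral_comp_inv_smul,
    abs_of_nonneg (by positivity)]
  rw [norm_inv_smul_sub hh, le_div_iff₀ hh]
  exact le_of_not_gt fun hlt => hz (hA (Metric.mem_ball.2 (by linarith)))

variable [HasContDiffBump E]

theorem setIntegral_cellBump (hh : 0 < h) (hA : Metric.ball c (h / 2) ⊆ A) :
    ∫ z in A, cellBump a h c z ∂μ =
      a * h * (h ^ Module.finrank ℝ E * ∫ u, unitBump E u ∂μ) := by
  simp only [cellBump]
  rw [integral_const_mul, setIntegral_comp_inv_smul_sub (G := unitBump E) hh hA fun u hu =>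
    unitBump_eq_zero (by linarith), smul_eq_mul]

theorem setIntegral_sq_fderiv_cellBump (hh : 0 < h) (hA : Metric.ball c (h / 2) ⊆ A) (v : E) :
    ∫ z in A, (fderiv ℝ (cellBump a h c) z v) ^ 2 ∂μ =
      a ^ 2 * (h ^ Module.finrank ℝ E * ∫ u, (fderiv ℝ (unitBump E) u v) ^ 2 ∂μ) := by
  have hscale : ∀ z, (fderiv ℝ (cellBump a h c) z v) ^ 2 =
      a ^ 2 * (fun u => (fderiv ℝ (unitBump E) u v) ^ 2) (h⁻¹ • (z - c)) := fun z => by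
    rw [fderiv_cellBump c hh.ne', smul_apply, smul_eq_mul, mul_pow]
  simp_rw [hscale]
  rw [integral_const_mul, setIntegral_comp_inv_smul_sub
    (G := fun u => (fderiv ℝ (unitBump E) u v) ^ 2) hh hA fun u hu => ?_, smul_eq_mul]
  rw [fderiv_unitBump_eq_zero (by linarith), zero_apply, sq, mul_zero]

end Integral

theorem lintegral_ofReal_one_add_sq {X : Type*} [MeasurableSpace X] {μ : Measure X}
    [IsProbabilityMeasure μ] {D : X → ℝ} (hD : MemLp D 2 μ) (hD1 : ∀ x, 0 ≤ 1 + D x)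
    (hmass : ∫⁻ x, ENNReal.ofReal (1 + D x) ∂μ = 1) :
    ∫⁻ x, ENNReal.ofReal (1 + D x) ^ 2 ∂μ = ENNReal.ofReal (1 + ∫ x, D x ^ 2 ∂μ) := by
  have hint : Integrable D μ := hD.integrable one_le_two
  have hone : Integrable (fun x => 1 + D x) μ := (integrable_const 1).add hint
  have hlin : Integrable (fun x => 1 + 2 * D x) μ := (integrable_const 1).add (hint.const_mul 2)
  have hquad : Integrable (fun x => 1 + 2 * D x + D x ^ 2) μ := hlin.add hD.integrable_sq
  have hmean : ∫ x, D x ∂μ = 0 := by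
    rw [← ofReal_integral_eq_lintegral_ofReal hone (.of_forall hD1), ENNReal.ofReal_eq_one,
      integral_add (integrable_const 1) hint] at hmass
    simpa using hmass
  have hexpand : ∀ x, (1 + D x) ^ 2 = 1 + 2 * D x + D x ^ 2 := fun x => by ring
  calc ∫⁻ x, ENNReal.ofReal (1 + D x) ^ 2 ∂μ
      = ∫⁻ x, ENNReal.ofReal (1 + 2 * D x + D x ^ 2) ∂μ := by
        simp_rw [← hexpand, ENNReal.ofReal_pow (hD1 _)]
    _ = ENNReal.ofReal (∫ x, (1 + 2 * D x + D x ^ 2) ∂μ) :=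
        (ofReal_integral_eq_lintegral_ofReal hquad
          (.of_forall fun x => (sq_nonneg (1 + D x)).trans_eq (hexpand x))).symm
    _ = ENNReal.ofReal (1 + ∫ x, D x ^ 2 ∂μ) := by
        rw [integral_add hlin hD.integrable_sq, integral_add (integrable_const 1)
          (hint.const_mul 2), integral_const_mul, hmean]
        simp

theorem one_add_pow_le_two {δ : ℝ} {n : ℕ} (hδ : 0 ≤ δ) (hn : n * δ ≤ 1 / 2) :
    (1 + δ) ^ n ≤ 2 := by
  calc (1 + δ) ^ n ≤ Real.exp δ ^ n := by
        gcongr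
        rw [add_comm]
        exact Real.add_one_le_exp δ
    _ = Real.exp (n * δ) := (Real.exp_nat_mul δ n).symm
    _ ≤ Real.exp (Real.log 2) := by
        gcongr
        linarith [Real.log_two_gt_d9]
    _ = 2 := Real.exp_log two_pos

theorem lintegral_ofReal_one_add_sq_pow_le_two {X : Type*} [MeasurableSpace X] {μ : Measure X}
    [IsProbabilityMeasure μ] {D : X → ℝ} (hD : MemLp D 2 μ) (hD1 : ∀ x, 0 ≤ 1 + D x)
    (hmass : ∫⁻ x, ENNReal.ofReal (1 + D x) ∂μ = 1) {n : ℕ} (hn : n * ∫ x, D x ^ 2 ∂μ ≤ 1 / 2) :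
    (∫⁻ x, ENNReal.ofReal (1 + D x) ^ 2 ∂μ) ^ n ≤ 2 := by
  have hnonneg : 0 ≤ ∫ x, D x ^ 2 ∂μ := integral_nonneg fun x => sq_nonneg (D x)
  rw [lintegral_ofReal_one_add_sq hD hD1 hmass, ← ENNReal.ofReal_pow (by positivity)]
  exact ENNReal.ofReal_le_ofNat.2 (one_add_pow_le_two hnonneg hn)

theorem lintegral_eq_one_of_map_withDensity {X Y : Type*} [MeasurableSpace X] [MeasurableSpace Y]
    {μ : Measure X} {ν : Measure Y} [IsProbabilityMeasure ν] {τ : X → Y} (hτ : Measurable τ)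
    {J : X → ℝ≥0∞} (hmap : (μ.withDensity J).map τ = ν) : ∫⁻ x, J x ∂μ = 1 := by
  rw [← setLIntegral_univ, ← withDensity_apply _ .univ, ← Set.preimage_univ (f := τ),
    ← Measure.map_apply hτ .univ, hmap, measure_univ]

section DataLaw

variable {d D n : ℕ} {g : EuclideanSpace ℝ (Fin d) → EuclideanSpace ℝ (Fin D)}

/-- The law of `g` is also the law of `g ∘ τ` under the density `J`, so both data laws are images
under the same map, and mapping only increases the affinity. -/
theorem half_le_testingAffinity_pi_dataLaw_comp (hg : Measurable g)
    {τ : EuclideanSpace ℝ (Fin d) → EuclideanSpace ℝ (Fin d)} (hτ : Measurable τ)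
    {J : EuclideanSpace ℝ (Fin d) → ℝ≥0∞} (hJ : Measurable J)
    (hmap : ((uniformCube d).withDensity J).map τ = uniformCube d)
    (hJ2 : (∫⁻ z, J z ^ 2 ∂(uniformCube d)) ^ n ≤ 2) (σ : ℝ) :
    1 / 2 ≤ testingAffinity (Measure.pi fun _ : Fin n => dataLaw g σ)
      (Measure.pi fun _ : Fin n => dataLaw (g ∘ τ) σ) := by
  have hlaw : generatedLaw g = ((uniformCube d).withDensity J).map (g ∘ τ) := by
    rw [← Measure.map_map hg hτ, hmap, generatedLaw]
  rw [testingAffinity_comm]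
  simp only [dataLaw, hlaw]
  exact half_le_testingAffinity_pi_map_conv _ _ (hg.comp hτ) hJ
    (lintegral_eq_one_of_map_withDensity hτ hmap) (by rwa [Fintype.card_fin])

theorem half_le_testingAffinity_pi_dataLaw_comp_shear_cellBump (hg : Measurable g) {a h : ℝ}
    (ha : 0 ≤ a) (ha' : a ≤ 1 / 16) (hh : 0 < h) {c v : EuclideanSpace ℝ (Fin d)} (hv : ‖v‖ ≤ 1)
    (hc : Metric.ball c (h / 2) ⊆ unitCube d) {B : ℝ}
    (hB : ∀ x, ‖fderiv ℝ (unitBump (EuclideanSpace ℝ (Fin d))) x‖ ≤ B) (haB : a * B ≤ 1 / 2)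
    (hn : n * (a ^ 2 * (h ^ d *
      ∫ u, (fderiv ℝ (unitBump (EuclideanSpace ℝ (Fin d))) u v) ^ 2)) ≤ 1 / 2) (σ : ℝ) :
    1 / 2 ≤ testingAffinity (Measure.pi fun _ : Fin n => dataLaw g σ)
      (Measure.pi fun _ : Fin n => dataLaw (g ∘ shear (cellBump a h c) v) σ) := by
  have hsmooth : ContDiff ℝ 1 (cellBump a h c) := contDiff_cellBump c
  have hdiff : Differentiable ℝ (cellBump a h c) := hsmooth.differentiable one_ne_zero
  have hslope : ∀ z, ‖fderiv ℝ (cellBump a h c) z‖ ≤ 1 / 2 := fun z =>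
    (norm_fderiv_cellBump_le c ha hh.ne' hB z).trans haB
  have hlip : LipschitzWith (1 / 2) (cellBump a h c) :=
    lipschitzWith_of_nnnorm_fderiv_le hdiff fun z => by
      rw [← NNReal.coe_le_coe]
      simpa using hslope z
  have hdir : ∀ z, ‖fderiv ℝ (cellBump a h c) z v‖ ≤ 1 / 2 := fun z => by
    simpa using (fderiv ℝ (cellBump a h c) z).le_of_opNorm_le_of_le (hslope z) hv
  have hcont : Continuous fun z => fderiv ℝ (cellBump a h c) z v :=
    (hsmooth.continuous_fderiv one_ne_zero).clm_apply continuous_const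
  have hshear : Measurable (shear (cellBump a h c) v) :=
    (continuous_shear hsmooth.continuous).measurable
  have hJ : Measurable fun z => ENNReal.ofReal (1 + fderiv ℝ (cellBump a h c) z v) :=
    (measurable_const.add hcont.measurable).ennreal_ofReal
  have hmap : ((uniformCube d).withDensity fun z =>
      ENNReal.ofReal (1 + fderiv ℝ (cellBump a h c) z v)).map (shear (cellBump a h c) v) =
        uniformCube d :=
    map_withDensity_shear hlip hdiff
      ((mul_le_of_le_one_right' (by exact_mod_cast hv)).trans_lt (by norm_num))
      (measurableSet_unitCube d) (shear_cellBump_preimage ha ha' hh hv hc)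
  refine half_le_testingAffinity_pi_dataLaw_comp hg hshear hJ hmap
    (lintegral_ofReal_one_add_sq_pow_le_two
      (.of_bound hcont.aestronglyMeasurable (1 / 2) (.of_forall hdir))
      (fun z => by linarith [(abs_le.1 (hdir z)).1])
      (lintegral_eq_one_of_map_withDensity hshear hmap) ?_) σ
  rwa [uniformCube, setIntegral_sq_fderiv_cellBump hh hc, finrank_euclideanSpace_fin]

end DataLaw

/-! ### The minimax lower bound -/

theorem nonempty_linearIsometry_of_finrank_le {𝕜 E F : Type*} [RCLike 𝕜] [NormedAddCommGroup E]
    [InnerProductSpace 𝕜 E] [FiniteDimensional 𝕜 E] [NormedAddCommGroup F]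
    [InnerProductSpace 𝕜 F] [FiniteDimensional 𝕜 F]
    (h : Module.finrank 𝕜 E ≤ Module.finrank 𝕜 F) : Nonempty (E →ₗᵢ[𝕜] F) := by
  let b := stdOrthonormalBasis 𝕜 E
  let L : E →ₗ[𝕜] F := b.toBasis.constr 𝕜 fun i => stdOrthonormalBasis 𝕜 F (Fin.castLE h i)
  have hL : L ∘ b.toBasis = fun i => stdOrthonormalBasis 𝕜 F (Fin.castLE h i) :=
    funext fun i => b.toBasis.constr_basis 𝕜 _ i
  refine ⟨L.isometryOfOrthonormal (v := b.toBasis) ?_ ?_⟩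
  · rw [b.coe_toBasis]
    exact b.orthonormal
  · rw [hL]
    exact (stdOrthonormalBasis 𝕜 F).orthonormal.comp _ (Fin.castLE_injective h)

section LowerBound

variable {ι : Type*} {d D : ℕ} {a h : ℝ} {v : EuclideanSpace ℝ (Fin d)}
  {c : ι → EuclideanSpace ℝ (Fin d)}
  (L : EuclideanSpace ℝ (Fin d) →ₗᵢ[ℝ] EuclideanSpace ℝ (Fin D))

theorem continuous_isometry_comp_shear_bumpSum (s : Finset ι) :
    Continuous (L ∘ shear (bumpSum a h c s) v) :=
  L.continuous.comp (continuous_shear (contDiff_bumpSum (n := 0)).continuous)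

theorem integral_cellTest_generatedLaw_insert [DecidableEq ι] (ha : 0 ≤ a) (ha' : a ≤ 1 / 16)
    (hh : 0 < h) (hv : ‖v‖ = 1) (hc : Pairwise fun i j => h ≤ dist (c i) (c j)) {s : Finset ι}
    {j : ι} (hj : j ∉ s) (hcube : Metric.ball (c j) (h / 2) ⊆ unitCube d) :
    ∫ y, cellTest (L v) h (L (c j)) y ∂(generatedLaw (L ∘ shear (bumpSum a h c (insert j s)) v)) =
      ∫ y, cellTest (L v) h (L (c j)) y ∂(generatedLaw (L ∘ shear (bumpSum a h c s) v)) +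
        a * h * (h ^ d * ∫ u, unitBump (EuclideanSpace ℝ (Fin d)) u) := by
  have hmap : ∀ t : Finset ι, ∫ y, cellTest (L v) h (L (c j)) y
      ∂(generatedLaw (L ∘ shear (bumpSum a h c t) v)) =
        ∫ z, cellTest v h (c j) (shear (bumpSum a h c t) v z) ∂(uniformCube d) := fun t => by
    rw [generatedLaw, integral_map (continuous_isometry_comp_shear_bumpSum L t).aemeasurable
      (lipschitzWith_cellTest ((L.norm_map v).trans_le hv.le) _).continuous.aestronglyMeasurable]
    simp only [Function.comp_apply, cellTest_map]
  have htest : Integrable (fun z => cellTest v h (c j) (shear (bumpSum a h c s) v z))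
      (uniformCube d) :=
    .of_bound ((lipschitzWith_cellTest hv.le _).continuous.comp (continuous_shear
      (contDiff_bumpSum (n := 0)).continuous)).aestronglyMeasurable h
      (.of_forall fun z => abs_cellTest_le hh.le _ _)
  have hbump : Integrable (cellBump a h (c j)) (uniformCube d) :=
    (contDiff_cellBump (n := 0) (c j)).continuous.continuousOn.integrableOn_compact
      (isCompact_unitCube d)
  rw [hmap, hmap]
  simp_rw [cellTest_shear_bumpSum_insert ha ha' hh hv hc hj]
  rw [integral_add htest hbump, uniformCube, setIntegral_cellBump hh hcube,
    finrank_euclideanSpace_fin]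

theorem le_wassersteinMinimaxRisk_of_cells [Fintype ι]
    {G : Set (EuclideanSpace ℝ (Fin d) → EuclideanSpace ℝ (Fin D))}
    (ha : 0 ≤ a) (ha' : a ≤ 1 / 16) (hh : 0 < h) (hv : ‖v‖ = 1)
    (hc : Pairwise fun i j => h ≤ dist (c i) (c j))
    (hcube : ∀ j, Metric.ball (c j) (h / 2) ⊆ unitCube d) {B : ℝ}
    (hB : ∀ x, ‖fderiv ℝ (unitBump (EuclideanSpace ℝ (Fin d))) x‖ ≤ B) (haB : a * B ≤ 1 / 2)
    {n : ℕ} (hn : n * (a ^ 2 * (h ^ d *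
      ∫ u, (fderiv ℝ (unitBump (EuclideanSpace ℝ (Fin d))) u v) ^ 2)) ≤ 1 / 2)
    (hG : ∀ s, L ∘ shear (bumpSum a h c s) v ∈ G) (σ : ℝ) :
    ENNReal.ofReal (Fintype.card ι *
        (a * h * (h ^ d * ∫ u, unitBump (EuclideanSpace ℝ (Fin d)) u)) / 8) ≤
      wassersteinMinimaxRisk G σ n := by
  classical
  set δ := a * h * (h ^ d * ∫ u, unitBump (EuclideanSpace ℝ (Fin d)) u)
  have hcont : ∀ s, Continuous (L ∘ shear (bumpSum a h c s) v) :=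
    continuous_isometry_comp_shear_bumpSum L
  have : ∀ s, IsProbabilityMeasure (generatedLaw (L ∘ shear (bumpSum a h c s) v)) := fun s =>
    Measure.isProbabilityMeasure_map (hcont s).aemeasurable
  have hLc : Pairwise fun i j => h ≤ dist (L (c i)) (L (c j)) := by simpa only [L.dist_map] using hc
  have heighth : (8 : ℝ≥0∞)⁻¹ = 2⁻¹ * (2⁻¹ * 2⁻¹) := by
    rw [← ENNReal.mul_inv (.inl two_ne_zero) (.inl ENNReal.ofNat_ne_top),
      ← ENNReal.mul_inv (.inl two_ne_zero) (.inl ENNReal.ofNat_ne_top)]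
    norm_num
  calc ENNReal.ofReal (Fintype.card ι * δ / 8)
      = Fintype.card ι * (ENNReal.ofReal δ * (1 / 2) / 2) / 2 := by
        rw [mul_div_assoc, ENNReal.ofReal_mul (by positivity), ENNReal.ofReal_natCast,
          ENNReal.ofReal_div_of_pos (by norm_num), ENNReal.ofReal_ofNat]
        simp only [div_eq_mul_inv, one_mul, mul_assoc, heighth]
    _ ≤ wassersteinMinimaxRisk G σ n :=
        le_wassersteinMinimaxRisk (φ := fun j => cellTest (L v) h (L (c j))) hG
          (fun j => lipschitzWith_cellTest ((L.norm_map v).trans_le hv.le) _)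
          (fun j => abs_cellTest_le hh.le _) (disjoint_support_cellTest hLc)
          (fun s j hj => by
            rw [← shear_bumpSum_comp_shear_cellBump ha ha' hh hv.le hc hj, ← Function.comp_assoc]
            exact half_le_testingAffinity_pi_dataLaw_comp_shear_cellBump (hcont s).measurable ha ha'
              hh hv.le (hcube j) hB haB hn σ)
          fun s j hj => by
            rw [integral_cellTest_generatedLaw_insert L ha ha' hh hv hc hj (hcube j),
              edist_comm, edist_dist, dist_self_add_left]
            exact ENNReal.ofReal_le_ofReal (le_abs_self δ)

theorem le_wassersteinMinimaxRisk_of_grid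
    {G : Set (EuclideanSpace ℝ (Fin d) → EuclideanSpace ℝ (Fin D))} (ha : 0 ≤ a)
    (ha' : a ≤ 1 / 16) {m : ℕ} (hm : 1 ≤ m) (hv : ‖v‖ = 1) {B : ℝ}
    (hB : ∀ x, ‖fderiv ℝ (unitBump (EuclideanSpace ℝ (Fin d))) x‖ ≤ B) (haB : a * B ≤ 1 / 2)
    {n : ℕ} (hn : n * a ^ 2 / (m : ℝ) ^ d *
      ∫ u, (fderiv ℝ (unitBump (EuclideanSpace ℝ (Fin d))) u v) ^ 2 ≤ 1 / 2)
    (hG : ∀ s, L ∘ shear (bumpSum a (m : ℝ)⁻¹ (gridCentre (d := d) (m := m)) s) v ∈ G) (σ : ℝ) :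
    ENNReal.ofReal ((∫ u, unitBump (EuclideanSpace ℝ (Fin d)) u) / 8 * (a * (m : ℝ)⁻¹)) ≤
      wassersteinMinimaxRisk G σ n := by
  have hm0 : (0 : ℝ) < m := by exact_mod_cast hm
  have hcard : (Fintype.card (Fin d → Fin m) : ℝ) * (m : ℝ)⁻¹ ^ d = 1 := by
    rw [Fintype.card_fun, Fintype.card_fin, Fintype.card_fin, Nat.cast_pow, ← mul_pow,
      mul_inv_cancel₀ hm0.ne', one_pow]
  refine le_of_eq_of_le ?_ (le_wassersteinMinimaxRisk_of_cells L ha ha' (inv_pos.2 hm0) hv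
    le_dist_gridCentre ball_gridCentre_subset hB haB (le_of_eq_of_le ?_ hn) hG σ)
  · congr 1
    linear_combination (-(∫ u, unitBump (EuclideanSpace ℝ (Fin d)) u) / 8 * (a * (m : ℝ)⁻¹)) * hcard
  · rw [inv_pow]
    ring

end LowerBound

theorem exists_forall_comp_shear_bumpSum_mem_generatorClass (d : ℕ) {β : ℝ} (hβ : 0 < β) :
    ∃ K₀ : ℝ, ∀ K, K₀ ≤ K → ∀ {ι : Type*} {D : ℕ} {a h : ℝ} {v : EuclideanSpace ℝ (Fin d)}
      {c : ι → EuclideanSpace ℝ (Fin d)} {s : Finset ι}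
      (L : EuclideanSpace ℝ (Fin d) →ₗᵢ[ℝ] EuclideanSpace ℝ (Fin D)), 0 ≤ a → 0 < h → h ≤ 1 →
      a * h ^ (1 - β) ≤ 1 → ‖v‖ ≤ 1 → (Pairwise fun i j => h ≤ dist (c i) (c j)) →
      L ∘ shear (bumpSum a h c s) v ∈ generatorClass d D β K := by
  set k := holderOrder β
  set α := β - k with hα
  have hα0 : 0 ≤ α := (sub_pos.2 (holderOrder_lt hβ)).le
  have hα1 : α ≤ 1 := sub_holderOrder_le_one β
  obtain ⟨B, hB0, hB⟩ :=
    exists_bound_iteratedFDeriv_unitBump (E := EuclideanSpace ℝ (Fin d)) (k + 1)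
  obtain ⟨B₀, hid⟩ := HolderBoundOn.exists_of_contDiff (s := k) (convex_unitCube d)
    (isCompact_unitCube d) hα0 hα1 contDiff_id
  refine ⟨2 * (B₀ + 2 * B), fun K hK ι D a h v c s L ha hh hh1 hah hv hc => ?_⟩
  have hscale : 2 * (a * h * B * h ^ (-(k + α))) ≤ 2 * B := by
    calc 2 * (a * h * B * h ^ (-(k + α))) = a * h ^ (1 - β) * (2 * B) := by
          rw [hα, add_sub_cancel, sub_eq_add_neg, Real.rpow_add hh, Real.rpow_one]
          ring
      _ ≤ 2 * B := mul_le_of_le_one_left (by positivity) hah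
  have hbump : HolderBoundOn k α (unitCube d) (2 * B) (bumpSum a h c s) :=
    (holderBoundOn_bumpSum ha hh hh1 hc hα0 hα1 hB0 hB (convex_unitCube d)).mono hscale
  exact ((hid.shear hbump hv).clm_comp L.norm_toContinuousLinearMap_le).mem_generatorClass
    (by rwa [one_mul])

theorem exists_le_wassersteinMinimaxRisk {d : ℕ} (hd : 1 ≤ d) {β : ℝ} (hβ : 0 < β) :
    ∃ K₀ a₀ κ : ℝ, 0 < a₀ ∧ 0 < κ ∧ ∀ K, K₀ ≤ K → ∀ D, d ≤ D → ∀ (σ : ℝ) (n m : ℕ), 1 ≤ m →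
      ∀ a : ℝ, 0 ≤ a → a ≤ a₀ → a * (m : ℝ) ^ (β - 1) ≤ a₀ → n * a ^ 2 ≤ a₀ ^ 2 * (m : ℝ) ^ d →
      ENNReal.ofReal (κ * (a * (m : ℝ)⁻¹)) ≤
        wassersteinMinimaxRisk (generatorClass d D β K) σ n := by
  let v : EuclideanSpace ℝ (Fin d) := EuclideanSpace.single ⟨0, hd⟩ 1
  have hv : ‖v‖ = 1 := by simp [v]
  obtain ⟨K₀, hK₀⟩ := exists_forall_comp_shear_bumpSum_mem_generatorClass d hβ
  obtain ⟨B, hB0, hB⟩ := exists_bound_iteratedFDeriv_unitBump (E := EuclideanSpace ℝ (Fin d)) 1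
  set V := ∫ u, (fderiv ℝ (unitBump (EuclideanSpace ℝ (Fin d))) u v) ^ 2
  have hV : 0 ≤ V := integral_nonneg fun u => sq_nonneg _
  obtain ⟨a₀, ⟨⟨ha₀1, ha₀B⟩, ha₀V⟩, ha₀⟩ : ∃ a₀ : ℝ,
      ((a₀ ≤ 1 / 16 ∧ a₀ * B ≤ 1 / 2) ∧ a₀ ^ 2 * V ≤ 1 / 2) ∧ 0 < a₀ := by
    have hsmall : ∀ {f : ℝ → ℝ} {r : ℝ}, Continuous f → f 0 = 0 → 0 < r →
        ∀ᶠ x in nhds 0, f x ≤ r := fun hf h0 hr =>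
      (hf.tendsto' 0 0 h0).eventually_le_const hr
    exact ((((hsmall continuous_id rfl (by norm_num)).and
      (hsmall (by fun_prop) (zero_mul B) (by norm_num))).and
      (hsmall (by fun_prop) (by simp) (by norm_num))).filter_mono nhdsWithin_le_nhds |>.and
      (self_mem_nhdsWithin (s := Set.Ioi 0))).exists
  refine ⟨K₀, a₀, (∫ u, unitBump (EuclideanSpace ℝ (Fin d)) u) / 8, ha₀,
    div_pos (unitBump _).integral_pos (by norm_num), fun K hK D hD σ n m hm a ha haa₀ haβ hna => ?_⟩
  obtain ⟨L⟩ := nonempty_linearIsometry_of_finrank_le (𝕜 := ℝ) (E := EuclideanSpace ℝ (Fin d))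
    (F := EuclideanSpace ℝ (Fin D)) (by simpa using hD)
  have hm0 : (0 : ℝ) < m := by exact_mod_cast hm
  have hsample : n * a ^ 2 / (m : ℝ) ^ d * V ≤ 1 / 2 :=
    (mul_le_mul_of_nonneg_right ((div_le_iff₀ (by positivity)).2 hna) hV).trans ha₀V
  have hah : a * (m : ℝ)⁻¹ ^ (1 - β) ≤ 1 := by
    rw [Real.inv_rpow hm0.le, ← Real.rpow_neg hm0.le, neg_sub]
    linarith
  exact le_wassersteinMinimaxRisk_of_grid L ha (haa₀.trans ha₀1) hm hv
    (fun x => (norm_iteratedFDeriv_one (𝕜 := ℝ) _).symm.trans_le (hB 1 le_rfl x))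
    ((mul_le_mul_of_nonneg_right haa₀ hB0).trans ha₀B) hsample (fun s => hK₀ K hK L ha
      (inv_pos.2 hm0) (inv_le_one_of_one_le₀ (by exact_mod_cast hm)) hah hv.le le_dist_gridCentre) σ

theorem exists_nat_ge_rpow {x p : ℝ} (hx : 1 ≤ x) (hp : 0 < p) :
    ∃ m : ℕ, 1 ≤ m ∧ x ≤ (m : ℝ) ^ p ∧ m ≤ 2 * x ^ (1 / p) := by
  have hroot : 1 ≤ x ^ (1 / p) := Real.one_le_rpow hx (by positivity)
  refine ⟨⌈x ^ (1 / p)⌉₊, Nat.one_le_ceil_iff.2 (by linarith), ?_, ?_⟩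
  · calc x = (x ^ (1 / p)) ^ p := by
          rw [← Real.rpow_mul (by linarith), one_div_mul_cancel hp.ne', Real.rpow_one]
      _ ≤ (⌈x ^ (1 / p)⌉₊ : ℝ) ^ p :=
          Real.rpow_le_rpow (by linarith) (Nat.le_ceil _) hp.le
  · linarith [Nat.ceil_lt_add_one (zero_le_one.trans hroot)]

theorem exists_rpow_neg_half_le_wassersteinMinimaxRisk {d : ℕ} (hd : 1 ≤ d) {β : ℝ} (hβ : 0 < β) :
    ∃ K₀ C : ℝ, 0 < C ∧ ∀ K, K₀ ≤ K → ∀ D, d ≤ D → ∀ (σ : ℝ) (n : ℕ), 1 ≤ n →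
      ENNReal.ofReal (C * (n : ℝ) ^ (-(1 / 2) : ℝ)) ≤
        wassersteinMinimaxRisk (generatorClass d D β K) σ n := by
  obtain ⟨K₀, a₀, κ, ha₀, hκ, hrisk⟩ := exists_le_wassersteinMinimaxRisk hd hβ
  refine ⟨K₀, κ * a₀, by positivity, fun K hK D hD σ n hn => ?_⟩
  have hn0 : (0 : ℝ) < n := by exact_mod_cast hn
  set a := a₀ * (n : ℝ) ^ (-(1 / 2) : ℝ) with ha
  have haa₀ : a ≤ a₀ := mul_le_of_le_one_right ha₀.le
    (Real.rpow_le_one_of_one_le_of_nonpos (by exact_mod_cast hn) (by norm_num))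
  have hsq : n * a ^ 2 = a₀ ^ 2 := by
    rw [ha, mul_pow, ← Real.rpow_mul_natCast hn0.le, Nat.cast_two, neg_mul,
      one_div_mul_cancel two_ne_zero, Real.rpow_neg_one, mul_left_comm, mul_inv_cancel₀ hn0.ne',
      mul_one]
  have hone := hrisk K hK D hD σ n 1 le_rfl a (by positivity) haa₀ (by simpa using haa₀)
    (by simpa using hsq.le)
  rwa [Nat.cast_one, inv_one, mul_one, ha, ← mul_assoc] at hone

theorem exists_rpow_le_wassersteinMinimaxRisk {d : ℕ} (hd : 1 ≤ d) {β : ℝ} (hβ : 1 ≤ β) :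
    ∃ K₀ C : ℝ, 0 < C ∧ ∀ K, K₀ ≤ K → ∀ D, d ≤ D → ∀ (σ : ℝ) (n : ℕ), 1 ≤ n →
      ENNReal.ofReal (C * (n : ℝ) ^ (-(β / (2 * β + d - 2)))) ≤
        wassersteinMinimaxRisk (generatorClass d D β K) σ n := by
  obtain ⟨K₀, a₀, κ, ha₀, hκ, hrisk⟩ := exists_le_wassersteinMinimaxRisk hd (by linarith : 0 < β)
  refine ⟨K₀, κ * (a₀ * 2 ^ (-β)), by positivity, fun K hK D hD σ n hn => ?_⟩
  set p := 2 * β + d - 2 with hp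
  have hp0 : 0 < p := by
    have : (1 : ℝ) ≤ d := by exact_mod_cast hd
    linarith
  obtain ⟨m, hm, hnm, hmn⟩ := exists_nat_ge_rpow (x := n) (by exact_mod_cast hn) hp0
  have hm1 : (1 : ℝ) ≤ m := by exact_mod_cast hm
  have hm0 : (0 : ℝ) < m := zero_lt_one.trans_le hm1
  set a := a₀ * (m : ℝ) ^ (1 - β) with ha
  have haa₀ : a ≤ a₀ := mul_le_of_le_one_right ha₀.le
    (Real.rpow_le_one_of_one_le_of_nonpos hm1 (by linarith))
  have haβ : a * (m : ℝ) ^ (β - 1) = a₀ := by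
    rw [ha, mul_assoc, ← Real.rpow_add hm0, sub_add_sub_cancel, sub_self, Real.rpow_zero, mul_one]
  have hsample : n * a ^ 2 ≤ a₀ ^ 2 * (m : ℝ) ^ d := by
    calc n * a ^ 2 ≤ (m : ℝ) ^ p * a ^ 2 := by gcongr
      _ = a₀ ^ 2 * (m : ℝ) ^ d := by
          rw [ha, mul_pow, ← Real.rpow_mul_natCast hm0.le, mul_left_comm, ← Real.rpow_add hm0,
            ← Real.rpow_natCast (m : ℝ) d]
          congr 2
          push_cast
          rw [hp]
          ring
  refine (ENNReal.ofReal_le_ofReal ?_).trans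
    (hrisk K hK D hD σ n m hm a (by positivity) haa₀ haβ.le hsample)
  calc κ * (a₀ * 2 ^ (-β)) * (n : ℝ) ^ (-(β / p)) = κ * (a₀ * (2 * (n : ℝ) ^ (1 / p)) ^ (-β)) := by
        rw [Real.mul_rpow two_pos.le (by positivity), ← Real.rpow_mul n.cast_nonneg, mul_neg,
          one_div_mul_eq_div, mul_assoc, mul_assoc]
    _ ≤ κ * (a₀ * (m : ℝ) ^ (-β)) := by
        gcongr κ * (a₀ * ?_)
        exact Real.rpow_le_rpow_of_nonpos hm0 hmn (by linarith)
    _ = κ * (a * (m : ℝ)⁻¹) := by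
        rw [ha, mul_assoc, ← Real.rpow_neg_one (m : ℝ), ← Real.rpow_add hm0]
        congr 3
        ring

end

theorem theorem4 (d : ℕ) (hd : 1 ≤ d) (β : ℝ) (hβ : 0 < β)
    (hpos : 0 < 2 * β + d - 2) (hreg : d ≤ 2 ∨ 1 ≤ β) :
    ∃ K₀ : ℝ, ∃ C : ℝ, 0 < C ∧
      ∀ K : ℝ, K₀ ≤ K → ∀ D : ℕ, d ≤ D → ∀ σ₀ : ℝ, 0 ≤ σ₀ → ∀ n : ℕ, 1 ≤ n →
        ENNReal.ofReal (C * (n : ℝ) ^ (-(β / (2 * β + d - 2)))) ≤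
          wassersteinMinimaxRisk (generatorClass d D β K) σ₀ n := by
  rcases hreg with hd2 | hβ1
  · obtain ⟨K₀, C, hC, hrisk⟩ := exists_rpow_neg_half_le_wassersteinMinimaxRisk hd hβ
    refine ⟨K₀, C, hC, fun K hK D hD σ₀ _ n hn => le_trans ?_ (hrisk K hK D hD σ₀ n hn)⟩
    have hrate : 1 / 2 ≤ β / (2 * β + d - 2) := by
      have : (d : ℝ) ≤ 2 := by exact_mod_cast hd2
      rw [div_le_div_iff₀ two_pos hpos]
      linarith
    gcongr
    exact_mod_cast hn
  · obtain ⟨K₀, C, hC, hrisk⟩ := exists_rpow_le_wassersteinMinimaxRisk hd hβ1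
    exact ⟨K₀, C, hC, fun K hK D hD σ₀ _ n hn => hrisk K hK D hD σ₀ n hn⟩
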